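/- For an abelian group $A$, write $x\equiv y$ ("modulo 2-torsion") if $2(x-y)=0$. For a commutative ring $R$ let $\bigotimes^n R^*$ be the $n$-th tensor power over $\mathbb Z$ of its group of units. For a free $R$-module $V$ of rank $n$ with a volume form $\omega$ (a generator of $\det V^*$) put $\Delta(v_1,\dots,v_n)=\omega(v_1,\dots,v_n)$. A family of at least $n$ vectors in $V$ is generic if any $n$ of them form a basis (over a field: any $k\le n$ of them are linearly independent). For a generic family $(l_1,\dots,l_{2n})$ in $V$ set $$ I_n(l_1,\dots,l_{2n})=\sum_{\sigma\in S_{2n}}\operatorname{sgn}(\sigma)\;\Delta(l_{\sigma(1)},\dots,l_{\sigma(n)})\otimes\Delta(l_{\sigma(2)},\dots,l_{\sigma(n+1)})\otimes\cdots\otimes\Delta(l_{\sigma(n)},\dots,l_{\sigma(2n-1)})\in\bigotimes^n R^*. $$ For a field $k$ let $G_n$ be the moduli space of generic configurations of $2n$ vectors in an $n$-dimensional vector space over $k$; it is identified with the variety of $n\times n$ matrices $X$ such that all maximal minors of $(1\,|\,X)$ are nonzero, via the configuration of the columns of $(1\,|\,X)$. Let $PG_n$ be the quotient of $G_n$ by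 the torus rescaling the $2n$ vectors. Applied to the columns of $(1\,|\,X)$ with $\omega=\det$, the formula above defines $I_n\in\bigotimes^n\mathcal O(G_n)^*$. For a field $F$ let $\pi_{k,n}:\bigotimes^n F^*\to\bigotimes^{k-1}F^*\otimes K_2(F)\otimes\bigotimes^{n-k-1}F^*$ be the map induced by $a\otimes b\mapsto\{a,b\}$ on the factors $k,k+1$. **Theorem 4.3.** Let $n\ge 1$. a) The columns of $(1\,|\,X)$ form a generic family over $\mathcal O(G_n)$, and $I_n$ is integrable: its image in $\bigotimes^n k(G_n)^*$ satisfies $\pi_{j,n}(I_n)\equiv 0$ for all $1\le j\le n-1$. More generally, for every field $K$, every $n$-dimensional $K$-vector space with a nonzero volume form, and every generic family $(l_1,\dots,l_{2n})$ in it, $\pi_{j,n}(I_n(l_1,\dots,l_{2n}))\equiv 0$ for all $1\le j\le n-1$. b) If $n\ge2$, then $I_n$ depends modulo 2-torsion only on the configuration of $2n$ points in projective space: for every commutative ring $R$, free $R$-modules $V,V'$ of rank $n$ with volume forms $\omega,\omega'$, a generic family $(l_i)$ in $V$, an isomorphism $g:V\to V'$ and units $a_i\in R^*$, $$I_n(a_1g(l_1),\dots,a_{2n}g(l_{2n}))\equiv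 I_n(l_1,\dots,l_{2n}),$$ the left side being formed with $\omega'$ and the right side with $\omega$. Moreover, $I_n\in\bigotimes^n\mathcal O(G_n)^*$ is congruent modulo 2-torsion to the image of an element of $\bigotimes^n\mathcal O(PG_n)^*$. For all $n\ge1$ and all commutative rings $R$ one has two $(2n+1)$-term relations (without additive constants): 1) for a generic family $(l_1,\dots,l_{2n+1})$ in a free $R$-module $V_n$ of rank $n$ with a volume form, $$\sum_{i=1}^{2n+1}(-1)^i I_n(l_1,\dots,\widehat{l_i},\dots,l_{2n+1})=0;$$ 2) for a generic family $(m_1,\dots,m_{2n+1})$ in a free $R$-module $V_{n+1}$ of rank $n+1$, $$\sum_{j=1}^{2n+1}(-1)^j I_n(m_j\,|\,m_1,\dots,\widehat{m_j},\dots,m_{2n+1})\equiv0,$$ where $(m_j\,|\,m_1,\dots,\widehat{m_j},\dots,m_{2n+1})$ is the family of images of the vectors $m_i$, $i\ne j$, in $V_{n+1}/\langle m_j\rangle$, for any choice of volume forms on these quotients. -/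

import Mathlib

open scoped TensorProduct BigOperators

noncomputable section

namespace Grassmannian

/-! ### Tensor powers of unit groups -/

/-- The multiplicative group of `R`, written additively so that it is a `ℤ`-module. -/
abbrev UnitGroup (R : Type*) [CommRing R] : Type _ := Additive Rˣ

/-- `⊗ⁿ G → ⊗ⁿ H` induced by a homomorphism of abelian groups `G → H`. -/
def mapTensor (n : ℕ) {G H : Type*} [CommGroup G] [CommGroup H] (f : G →* H) :
    (⨂[ℤ]^n (Additive G)) →ₗ[ℤ] (⨂[ℤ]^n (Additive H)) :=
  PiTensorProduct.map (fun _ => (MonoidHom.toAdditive f).toIntLinearMap)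

/-- Equality modulo 2-torsion: the difference is killed by `2`. -/
def EqModTwoTorsion {A : Type*} [AddCommGroup A] (x y : A) : Prop := (2 : ℤ) • (x - y) = 0

/-! ### `K₂` and integrability -/

/-- The subgroup of `F^* ⊗ F^*` generated by the Steinberg elements `a ⊗ (1 - a)`. -/
def steinberg (F : Type*) [Field F] : Submodule ℤ (⨂[ℤ]^2 (UnitGroup F)) :=
  Submodule.span ℤ {x | ∃ a b : Fˣ, (a : F) + (b : F) = 1 ∧
    x = PiTensorProduct.tprod ℤ (![Additive.ofMul a, Additive.ofMul b] : Fin 2 → UnitGroup F)}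

/-- `K₂(F) = F^* ⊗ F^* / ⟨a ⊗ (1 - a)⟩` (Matsumoto's presentation). -/
abbrev K2 (F : Type*) [Field F] : Type _ := (⨂[ℤ]^2 (UnitGroup F)) ⧸ steinberg F

/-- The projection `⊗^{p+2+q} F^* → ⊗^p F^* ⊗ K₂(F) ⊗ ⊗^q F^*`, `Id ⊗ π ⊗ Id`; with
`p = k - 1` and `q = n - k - 1` it is the map `π_{k,n}`. -/
def piK2 (F : Type*) [Field F] (p q : ℕ) :
    (⨂[ℤ]^(p + 2 + q) (UnitGroup F)) →ₗ[ℤ]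
      ((⨂[ℤ]^p (UnitGroup F)) ⊗[ℤ] K2 F) ⊗[ℤ] (⨂[ℤ]^q (UnitGroup F)) :=
  TensorProduct.map (TensorProduct.map LinearMap.id (steinberg F).mkQ) LinearMap.id ∘ₗ
    TensorProduct.map (TensorPower.mulEquiv (R := ℤ) (M := UnitGroup F) (n := p) (m := 2)).symm.toLinearMap
      LinearMap.id ∘ₗ
    (TensorPower.mulEquiv (R := ℤ) (M := UnitGroup F) (n := p + 2) (m := q)).symm.toLinearMap

/-- `x ∈ ⊗ⁿ F^*` is integrable: all its images in `⊗^{k-1} F^* ⊗ K₂(F) ⊗ ⊗^{n-k-1} F^*`,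
`1 ≤ k ≤ n - 1`, vanish (modulo 2-torsion). -/
def IsIntegrable {F : Type*} [Field F] {n : ℕ} (x : ⨂[ℤ]^n (UnitGroup F)) : Prop :=
  ∀ (p q : ℕ) (h : n = p + 2 + q),
    EqModTwoTorsion (piK2 F p q (TensorPower.cast ℤ (UnitGroup F) h x)) 0

/-! ### Generic configurations and the element `Iₙ` -/

section Config

variable {R : Type*} [CommRing R] {V : Type*} [AddCommGroup V] [Module R V]

/-- `ω` is a volume form on the free module `V` of rank `n`, that is, a generator of `det V^*`
(for a vector space of dimension `n` over a field: a nonzero alternating `n`-form). -/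
def IsVolumeForm {n : ℕ} (ω : V [⋀^Fin n]→ₗ[R] R) : Prop :=
  ∃ b : Module.Basis (Fin n) R V, IsUnit (ω b)

/-- A family of at least `n` vectors in a free module of rank `n` is generic if any `n` of them
form a basis. Over a field this says that any `k ≤ n` of them are linearly independent. -/
def IsGeneric {ι : Type*} (R : Type*) [CommRing R] {V : Type*} [AddCommGroup V] [Module R V]
    (n : ℕ) (l : ι → V) : Prop :=
  ∀ s : Fin n ↪ ι, LinearIndependent R (l ∘ s) ∧ ⊤ ≤ Submodule.span R (Set.range (l ∘ s))

/-- An element of `R` as an element of `R^*`; the value at non-units is never used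
(see `isUnit_of_isGeneric`). -/
def toUnitGroup (x : R) : UnitGroup R :=
  open Classical in if h : IsUnit x then Additive.ofMul h.unit else 0

/-- For a generic configuration all `Δ(l_{s 1}, …, l_{s n})` are invertible. -/
theorem isUnit_of_isGeneric {n : ℕ} {ι : Type*} {ω : V [⋀^Fin n]→ₗ[R] R} (hω : IsVolumeForm ω)
    {l : ι → V} (hl : IsGeneric R n l) (s : Fin n ↪ ι) : IsUnit (ω (l ∘ s)) := by
  obtain ⟨b, hb⟩ := hω
  let c : Module.Basis (Fin n) R V := Module.Basis.mk (hl s).1 (hl s).2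
  have hc : (c : Fin n → V) = l ∘ s := Module.Basis.coe_mk _ _
  have h1 : ω b = ω c * c.det b := by
    have := congrArg (fun f => f b) (AlternatingMap.eq_smul_basis_det c ω)
    simpa using this
  rw [h1] at hb
  rw [← hc]
  exact isUnit_of_mul_isUnit_left hb

/-- The summand of `Iₙ` for the ordering `v₁, …, v_{2n}` of the vectors:
`Δ(v₁, …, vₙ) ⊗ Δ(v₂, …, v_{n+1}) ⊗ … ⊗ Δ(vₙ, …, v_{2n-1})`, where `Δ` is the value of `ω`. -/
def windowTensor {n : ℕ} (ω : V [⋀^Fin n]→ₗ[R] R) (v : Fin (2 * n) → V) : ⨂[ℤ]^n (UnitGroup R) :=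
  PiTensorProduct.tprod ℤ (fun k : Fin n =>
    toUnitGroup (ω (fun j : Fin n => v ⟨(k : ℕ) + (j : ℕ), by omega⟩)))

/-- `Iₙ(l₁, …, l_{2n}) ∈ ⊗ⁿ R^*`, the alternating sum of `windowTensor` over all orderings. -/
def grassI {n : ℕ} (ω : V [⋀^Fin n]→ₗ[R] R) (l : Fin (2 * n) → V) : ⨂[ℤ]^n (UnitGroup R) :=
  ∑ σ : Equiv.Perm (Fin (2 * n)), ((Equiv.Perm.sign σ : ℤˣ) : ℤ) • windowTensor ω (l ∘ σ)

/-- The configuration `(m_j | m_1, …, m̂_j, …, m_{N+1})`: the images of the other vectors in the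
quotient of `V` by the line spanned by `m_j`. -/
def project (R : Type*) [CommRing R] {V : Type*} [AddCommGroup V] [Module R V] {N : ℕ}
    (m : Fin (N + 1) → V) (j : Fin (N + 1)) :
    Fin N → V ⧸ Submodule.span R {m j} :=
  fun i => Submodule.Quotient.mk (m (j.succAbove i))

end Config

/-! ### The moduli spaces `Gₙ` and `PGₙ`

Every generic configuration of `2n` vectors has a unique representative of the form
`(e₁, …, eₙ, x₁, …, xₙ)` in the coordinate space, so that `Gₙ` is the affine variety of
`n × n` matrices `X` such that all maximal minors of `(1 | X)` are nonzero. -/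

/-- The configuration `(e₁, …, eₙ, x₁, …, xₙ)`, where `x_j` is the `j`-th column of `X`. -/
def normalForm {n : ℕ} {R : Type*} [CommRing R] (X : Matrix (Fin n) (Fin n) R) :
    Fin (2 * n) → (Fin n → R) :=
  fun c => if h : (c : ℕ) < n then Pi.single ⟨c, h⟩ 1
    else fun i => X i ⟨(c : ℕ) - n, by omega⟩

/-- The function field `k(Gₙ)`, the rational functions in the entries of a matrix. -/
abbrev FunctionField (n : ℕ) (k : Type*) [Field k] : Type _ :=
  FractionRing (MvPolynomial (Fin n × Fin n) k)

/-- The matrix of coordinate functions. -/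
def genericMatrix (n : ℕ) (k : Type*) [Field k] :
    Matrix (Fin n) (Fin n) (FunctionField n k) :=
  fun i j => algebraMap (MvPolynomial (Fin n × Fin n) k) (FunctionField n k) (MvPolynomial.X (i, j))

/-- The standard volume form (the determinant) on `Rⁿ`. -/
abbrev stdVolume (n : ℕ) (R : Type*) [CommRing R] : (Fin n → R) [⋀^Fin n]→ₗ[R] R :=
  Matrix.detRowAlternating

/-- The coordinate ring `𝒪(Gₙ) ⊆ k(Gₙ)`: it is generated by the matrix entries and the inverses
of the maximal minors of `(1 | X)`. -/
def coordRing (n : ℕ) (k : Type*) [Field k] : Subalgebra k (FunctionField n k) :=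
  Algebra.adjoin k ({f | ∃ i j, f = genericMatrix n k i j} ∪
    {f | ∃ s : Fin n ↪ Fin (2 * n),
      f = (stdVolume n (FunctionField n k) (normalForm (genericMatrix n k) ∘ s))⁻¹})

/-- The universal configuration of `2n` vectors over `𝒪(Gₙ)`. -/
def universalConfig (n : ℕ) (k : Type*) [Field k] : Fin (2 * n) → (Fin n → coordRing n k) :=
  normalForm (fun i j => ⟨genericMatrix n k i j, Algebra.subset_adjoin (Or.inl ⟨i, j, rfl⟩)⟩)

/-- The element `Iₙ ∈ ⊗ⁿ 𝒪(Gₙ)^*`. -/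
def universalI (n : ℕ) (k : Type*) [Field k] : ⨂[ℤ]^n (UnitGroup (coordRing n k)) :=
  grassI (stdVolume n (coordRing n k)) (universalConfig n k)

/-- The inclusion `𝒪(Gₙ)^* → k(Gₙ)^*`. -/
def toFunctionField (n : ℕ) (k : Type*) [Field k] : (coordRing n k)ˣ →* (FunctionField n k)ˣ :=
  Units.map ((coordRing n k).val : coordRing n k →* FunctionField n k)

/-- Weight of a coordinate function under rescaling of the `2n` vectors, which acts on matrices by
`x_{ij} ↦ s_i x_{ij} t_j`. -/
def torusWeight (n : ℕ) (x : Fin n × Fin n) : (Fin n → ℕ) × (Fin n → ℕ) :=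
  (Pi.single x.1 1, Pi.single x.2 1)

/-- `𝒪(PGₙ)^* ⊆ 𝒪(Gₙ)^*`: since `PGₙ` is the quotient of `Gₙ` by the torus rescaling the vectors,
these are the torus invariant invertible functions, that is, quotients of two polynomials which
are homogeneous of the same weight. -/
def unitsPG (n : ℕ) (k : Type*) [Field k] : Subgroup (coordRing n k)ˣ where
  carrier := {u | ∃ (d : (Fin n → ℕ) × (Fin n → ℕ)) (p q : MvPolynomial (Fin n × Fin n) k),
    p ≠ 0 ∧ q ≠ 0 ∧ MvPolynomial.IsWeightedHomogeneous (torusWeight n) p d ∧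
    MvPolynomial.IsWeightedHomogeneous (torusWeight n) q d ∧
    ((u : coordRing n k) : FunctionField n k) =
      algebraMap _ (FunctionField n k) p / algebraMap _ (FunctionField n k) q}
  one_mem' := ⟨0, 1, 1, one_ne_zero, one_ne_zero, MvPolynomial.isWeightedHomogeneous_one _ _,
    MvPolynomial.isWeightedHomogeneous_one _ _, by simp⟩
  mul_mem' := by
    rintro u v ⟨d, p, q, hp, hq, hp', hq', hu⟩ ⟨e, r, s, hr, hs, hr', hs', hv⟩
    refine ⟨d + e, p * r, q * s, mul_ne_zero hp hr, mul_ne_zero hq hs, hp'.mul hr', hq'.mul hs', ?_⟩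
    rw [map_mul, map_mul, ← div_mul_div_comm, ← hu, ← hv]
    simp
  inv_mem' := by
    rintro u ⟨d, p, q, hp, hq, hp', hq', hu⟩
    refine ⟨d, q, p, hq, hp, hq', hp', ?_⟩
    have h : ((u : coordRing n k) : FunctionField n k) *
        (((u⁻¹ : (coordRing n k)ˣ) : coordRing n k) : FunctionField n k) = 1 := by
      exact_mod_cast congrArg (Subtype.val) u.mul_inv
    rw [eq_comm, ← inv_div, ← hu]
    exact inv_eq_of_mul_eq_one_right h

end Grassmannian

end

open Grassmannian

/-!
Twice a tensor in `⊗ⁿ R^*` does not change if one of its factors changes sign. Modulo 2-torsion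
the volumes `Δ(l_{i₁}, …, l_{iₙ})` may therefore be regarded as a function `φ` of the *set*
`{i₁, …, iₙ}` (`exists_isVolumeFunction`), and twice `Iₙ` is the alternating sum over `σ ∈ S_{2n}`
of the tensors with factors `φ(σ Wₖ)`, where the window `Wₖ` is `{k, …, k + n - 1}`
(`two_smul_map_grassI`). Everything then rests on which positions the windows can tell apart: among
pairs of cyclically consecutive positions modulo `2n`, the window `Wₖ` separates exactly
`(k - 1, k)` and `(k + n - 1, k + n)`, and no other window separates these two.

* Projective invariance (`altSum_window_congr`): a change of the volume form or a rescaling of the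
  vectors adds to the `k`-th factor terms depending on no vector or on a single vector of `Wₖ`.
  After the `k`-th factor is replaced by such a term, one of the two pairs above can be exchanged
  with no effect up to 2-torsion, so that the alternating sum vanishes. Rescaling the universal
  configuration so that `x_{ij}` becomes `x_{ij} x_{00} / (x_{i0} x_{0j})` shows that `Iₙ` comes
  from `PGₙ`.
* The `(2n+1)`-term relations: both sums are alternating sums over `S_{2n+1}`
  (`sum_altSum_succAbove`). In the first one the summand ignores two of the vectors; in the dual one
  all factors contain the vectors number `0` and `n`, which can be exchanged at the cost of signs.
* Integrability: the windows other than `W_p` and `W_{p+1}` do not separate the positions `p - 1`,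
  `p`, `p + 1`, nor the positions `p + n - 1`, `p + n`, `p + n + 1`. For `n ≥ 3` these six positions
  are distinct, and the alternating sum over the permutations of both triples already vanishes in
  `K₂` by the Steinberg relations attached to the three-term Plücker relations
  (`IsVolumeFunction.symbol_relation`, `altSum_fin_three_symbol`). For `n = 2` the whole sum over
  `S₄` is `-2` times one such relation (`altSum_fin_four_symbol`).
-/

namespace Grassmannian

open Equiv

/-! ### Units up to sign -/

section Signs

variable {R : Type*} [CommRing R]

theorem toUnitGroup_coe (u : Rˣ) : toUnitGroup (u : R) = Additive.ofMul u := by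
  unfold toUnitGroup
  rw [dif_pos u.isUnit]
  congr 1
  exact Units.ext rfl

theorem toUnitGroup_mul {x y : R} (hx : IsUnit x) (hy : IsUnit y) :
    toUnitGroup (x * y) = toUnitGroup x + toUnitGroup y := by
  obtain ⟨u, rfl⟩ := hx
  obtain ⟨v, rfl⟩ := hy
  rw [← Units.val_mul, toUnitGroup_coe, toUnitGroup_coe, toUnitGroup_coe, ofMul_mul]

/-- Equality of elements of `R^*` up to the factor `-1`. -/
def EqUpToSign (x y : UnitGroup R) : Prop := x = y ∨ x = y + Additive.ofMul (-1)

theorem ofMul_neg_one_add_self : (Additive.ofMul (-1) : UnitGroup R) + Additive.ofMul (-1) = 0 := by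
  rw [← ofMul_mul]; simp

namespace EqUpToSign

theorem refl (x : UnitGroup R) : EqUpToSign x x := Or.inl rfl

theorem trans {x y z : UnitGroup R} (h : EqUpToSign x y) (h' : EqUpToSign y z) :
    EqUpToSign x z := by
  rcases h with rfl | rfl <;> rcases h' with rfl | rfl
  · exact Or.inl rfl
  · exact Or.inr rfl
  · exact Or.inr rfl
  · left; rw [add_assoc, ofMul_neg_one_add_self, add_zero]

theorem add {x y x' y' : UnitGroup R} (h : EqUpToSign x y) (h' : EqUpToSign x' y') :
    EqUpToSign (x + x') (y + y') := by
  rcases h with rfl | rfl <;> rcases h' with rfl | rfl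
  · exact Or.inl rfl
  · right; abel
  · right; abel
  · left
    rw [add_add_add_comm, ofMul_neg_one_add_self, add_zero]

end EqUpToSign

theorem eqUpToSign_toUnitGroup_neg (x : R) : EqUpToSign (toUnitGroup (-x)) (toUnitGroup x) := by
  by_cases h : IsUnit x
  · obtain ⟨u, rfl⟩ := h
    right
    rw [← Units.val_neg, toUnitGroup_coe, toUnitGroup_coe, ← ofMul_mul]
    simp
  · left
    unfold toUnitGroup
    rw [dif_neg h, dif_neg (by simpa using h)]

theorem eqUpToSign_toUnitGroup_of_eq_or_neg {x y : R} (h : x = y ∨ x = -y) :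
    EqUpToSign (toUnitGroup x) (toUnitGroup y) := by
  rcases h with rfl | rfl
  · exact .refl _
  · exact eqUpToSign_toUnitGroup_neg _

/-- Permuting the arguments of an alternating form changes its value at most by a sign. -/
theorem eqUpToSign_toUnitGroup_comp_perm {V : Type*} [AddCommGroup V] [Module R V] {n : ℕ}
    (ω : V [⋀^Fin n]→ₗ[R] R) (v : Fin n → V) (π : Perm (Fin n)) :
    EqUpToSign (toUnitGroup (ω (v ∘ π))) (toUnitGroup (ω v)) := by
  apply eqUpToSign_toUnitGroup_of_eq_or_neg
  rw [ω.map_perm]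
  rcases Int.units_eq_one_or (Perm.sign π) with h | h <;> simp [h]

variable {A : Type*} [AddCommGroup A]

/-- A multilinear map on `(R^*)ⁿ` which vanishes as soon as one of the arguments is `-1`. -/
def KillsSign {n : ℕ} (T : MultilinearMap ℤ (fun _ : Fin n => UnitGroup R) A) : Prop :=
  ∀ (v : Fin n → UnitGroup R) (k : Fin n), T (Function.update v k (Additive.ofMul (-1))) = 0

theorem KillsSign.update_congr {n : ℕ} {T : MultilinearMap ℤ (fun _ : Fin n => UnitGroup R) A}
    (hT : KillsSign T) (v : Fin n → UnitGroup R) (k : Fin n) {x y : UnitGroup R}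
    (h : EqUpToSign x y) : T (Function.update v k x) = T (Function.update v k y) := by
  rcases h with rfl | rfl
  · rfl
  · rw [T.map_update_add, hT, add_zero]

/-- Telescoping over the arguments: a relation between multilinear expressions which holds when
one argument at a time is changed holds when all of them are changed. -/
theorem eq_of_forall_update {α β : Type*} {n : ℕ} (F : (Fin n → α) → β) (v w : Fin n → α)
    (h : ∀ (u : Fin n → α) (k : Fin n), (∀ j, u j = v j ∨ u j = w j) →
      F (Function.update u k (v k)) = F (Function.update u k (w k))) : F v = F w := by
  suffices H : ∀ s : Finset (Fin n), F (s.piecewise w v) = F v by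
    have := H Finset.univ
    rw [Finset.piecewise_univ] at this
    exact this.symm
  intro s
  induction s using Finset.induction_on with
  | empty => rw [Finset.piecewise_empty]
  | insert k s hk ih =>
    rw [Finset.piecewise_insert, ← ih, ← h]
    · congr 1
      rw [← Finset.piecewise_eq_of_notMem s w v hk, Function.update_eq_self]
    · intro j
      by_cases hj : j ∈ s
      · right; simp [hj]
      · left; simp [hj]

theorem KillsSign.congr {n : ℕ} {T : MultilinearMap ℤ (fun _ : Fin n => UnitGroup R) A}
    (hT : KillsSign T) {v w : Fin n → UnitGroup R} (h : ∀ k, EqUpToSign (v k) (w k)) :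
    T v = T w :=
  eq_of_forall_update T v w fun u k _ => hT.update_congr u k (h k)

/-- Twice a linear map on `⊗ⁿ R^*`, as a multilinear map on `(R^*)ⁿ`. -/
def twiceMultilinear {n : ℕ} (L : (⨂[ℤ]^n (UnitGroup R)) →ₗ[ℤ] A) :
    MultilinearMap ℤ (fun _ : Fin n => UnitGroup R) A :=
  (2 : ℤ) • L.compMultilinearMap (PiTensorProduct.tprod ℤ)

theorem twiceMultilinear_apply {n : ℕ} (L : (⨂[ℤ]^n (UnitGroup R)) →ₗ[ℤ] A)
    (v : Fin n → UnitGroup R) :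
    twiceMultilinear L v = (2 : ℤ) • L (PiTensorProduct.tprod ℤ v) := rfl

theorem killsSign_twiceMultilinear {n : ℕ} (L : (⨂[ℤ]^n (UnitGroup R)) →ₗ[ℤ] A) :
    KillsSign (twiceMultilinear L) := by
  intro v k
  have h0 : (2 : ℤ) • (Additive.ofMul (-1) : UnitGroup R) = 0 := by
    rw [two_zsmul, ofMul_neg_one_add_self]
  rw [twiceMultilinear_apply, ← L.map_smul, ← (PiTensorProduct.tprod ℤ).map_update_smul, h0,
    (PiTensorProduct.tprod ℤ).map_update_zero, map_zero]

end Signs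

/-! ### Alternating sums over permutations -/

section AltSum

variable {A : Type*} [AddCommGroup A] {N : ℕ}

/-- The alternating sum of a function on the symmetric group. -/
def altSum (E : Perm (Fin N) → A) : A := ∑ σ, ((Perm.sign σ : ℤˣ) : ℤ) • E σ

theorem altSum_congr {E E' : Perm (Fin N) → A} (h : ∀ σ, E σ = E' σ) : altSum E = altSum E' := by
  rw [funext h]

theorem altSum_add (E E' : Perm (Fin N) → A) :
    altSum (fun σ => E σ + E' σ) = altSum E + altSum E' := by
  simp [altSum, Finset.sum_add_distrib]

theorem altSum_sum {ι : Type*} (s : Finset ι) (E : ι → Perm (Fin N) → A) :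
    altSum (fun σ => ∑ i ∈ s, E i σ) = ∑ i ∈ s, altSum (E i) := by
  simp only [altSum, Finset.smul_sum]
  exact Finset.sum_comm

/-- If two positions play the same role, the terms of the alternating sum cancel in pairs. -/
theorem altSum_eq_zero_of_swap {E : Perm (Fin N) → A} {p q : Fin N} (hpq : p ≠ q)
    (h : ∀ σ, E (σ * swap p q) = E σ) : altSum E = 0 := by
  refine Finset.sum_involution (fun σ _ => σ * swap p q) ?_ ?_ (fun _ _ => Finset.mem_univ _) ?_
  · intro σ _
    rw [h, Perm.sign_mul, Perm.sign_swap hpq]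
    simp
  · intro σ _ _ he
    exact hpq (swap_eq_one_iff.mp (mul_eq_left.mp he))
  · intro σ _
    simp [mul_assoc]

/-- Development of an alternating sum over `S_{N+1}` according to the image of the first
position. -/
theorem sum_altSum_succAbove (F : (Fin (N + 1) → Fin (N + 1)) → A) :
    ∑ i : Fin (N + 1), (-1 : ℤ) ^ (i : ℕ) •
      altSum (fun σ : Perm (Fin N) => F (Fin.cons i (i.succAbove ∘ σ))) =
    altSum (fun τ : Perm (Fin (N + 1)) => F τ) := by
  let e : Fin (N + 1) × Perm (Fin N) → Perm (Fin (N + 1)) :=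
    fun x => x.1.cycleRange.symm * Perm.decomposeFin.symm (0, x.2)
  have he : ∀ x, (e x : Fin (N + 1) → Fin (N + 1)) = Fin.cons x.1 (x.1.succAbove ∘ x.2) := by
    intro x
    funext j
    refine Fin.cases ?_ (fun j => ?_) j
    · simp [e]
    · simp [e, Perm.decomposeFin_symm_apply_succ]
  have hb : Function.Bijective e := by
    rw [Fintype.bijective_iff_injective_and_card]
    constructor
    · rintro ⟨i, σ⟩ ⟨j, τ⟩ h
      have h' := congrArg (fun f : Perm (Fin (N + 1)) => (f : Fin (N + 1) → Fin (N + 1))) h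
      simp only [he] at h'
      obtain ⟨rfl, h2⟩ := Fin.cons_injective2 h'
      have h3 := Function.Injective.comp_left (Fin.succAbove_right_injective (p := i)) h2
      rw [DFunLike.coe_fn_eq.mp h3]
    · simp [Fintype.card_perm, Nat.factorial_succ]
  simp only [altSum, Finset.smul_sum]
  rw [← Finset.sum_product', Finset.univ_product_univ]
  refine Fintype.sum_bijective e hb _ _ ?_
  rintro ⟨i, σ⟩
  rw [he, smul_smul]
  congr 1
  have : (e (i, σ)) = i.cycleRange.symm * Perm.decomposeFin.symm (0, σ) := rfl
  rw [this, Perm.sign_mul, Perm.sign_symm, Fin.sign_cycleRange, Perm.decomposeFin.symm_sign]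
  simp

/-- An alternating sum vanishes if the partial sums over the cosets of a subgroup do. -/
theorem altSum_eq_zero_of_coset {H : Type*} [Group H] [Fintype H] (f : H →* Perm (Fin N))
    (hf : Function.Injective f) {E : Perm (Fin N) → A}
    (h : ∀ σ, ∑ x, ((Perm.sign (f x) : ℤˣ) : ℤ) • E (σ * f x) = 0) : altSum E = 0 := by
  classical
  let e : (Perm (Fin N) ⧸ f.range) × H → Perm (Fin N) := fun x => x.1.out * f x.2
  have hmk : ∀ x, (QuotientGroup.mk (e x) : Perm (Fin N) ⧸ f.range) = x.1 := by
    intro x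
    rw [QuotientGroup.mk_mul_of_mem _ (MonoidHom.mem_range.mpr ⟨x.2, rfl⟩)]
    exact QuotientGroup.out_eq' x.1
  have he : Function.Bijective e := by
    constructor
    · rintro ⟨q, x⟩ ⟨q', x'⟩ h
      have hq : q = q' := by
        have := hmk (q, x)
        rw [h, hmk] at this
        exact this.symm
      subst hq
      exact Prod.ext rfl (hf (mul_left_cancel h))
    · intro σ
      have h1 : (QuotientGroup.mk σ : Perm (Fin N) ⧸ f.range).out⁻¹ * σ ∈ f.range := by
        rw [← QuotientGroup.eq]
        exact QuotientGroup.out_eq' _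
      obtain ⟨x, hx⟩ := h1
      exact ⟨(QuotientGroup.mk σ, x), by simp [e, hx]⟩
  unfold altSum
  rw [← Fintype.sum_bijective e he (fun x => ((Perm.sign (e x) : ℤˣ) : ℤ) • E (e x)) _
    (fun x => rfl), Fintype.sum_prod_type]
  refine Finset.sum_eq_zero fun q _ => ?_
  have := congrArg (fun y => ((Perm.sign q.out : ℤˣ) : ℤ) • y) (h q.out)
  simpa [e, Finset.smul_sum, smul_smul] using this

end AltSum

/-! ### `Iₙ` in terms of sets of indices -/

section Windows

variable {n : ℕ}

/-- The set of positions `{k, …, k + n - 1}` entering the `k`-th factor of `Iₙ`. -/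
def window (n : ℕ) (k : Fin n) : Finset (Fin (2 * n)) :=
  Finset.univ.filter fun i => (k : ℕ) ≤ i ∧ (i : ℕ) < k + n

theorem mem_window {k : Fin n} {i : Fin (2 * n)} :
    i ∈ window n k ↔ (k : ℕ) ≤ i ∧ (i : ℕ) < k + n := by
  simp [window]

/-- The `k`-th factor of the summand of `Iₙ` as a list of positions. -/
def windowEmb (n : ℕ) (k : Fin n) : Fin n ↪ Fin (2 * n) :=
  ⟨fun j => ⟨(k : ℕ) + (j : ℕ), by omega⟩, fun a b h => by simpa [Fin.ext_iff] using h⟩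

theorem windowEmb_val (k j : Fin n) : (windowEmb n k j : ℕ) = k + j := rfl

theorem map_windowEmb (k : Fin n) : Finset.univ.map (windowEmb n k) = window n k := by
  ext i
  simp only [Finset.mem_map, Finset.mem_univ, true_and, mem_window, Fin.ext_iff, windowEmb_val]
  constructor
  · rintro ⟨a, ha⟩; omega
  · rintro ⟨h1, h2⟩; exact ⟨⟨i - k, by omega⟩, by simp only; omega⟩

theorem card_window (k : Fin n) : (window n k).card = n := by
  rw [← map_windowEmb]; simp

theorem map_mul_of_mem_iff {ι : Type*} {W : Finset ι} (σ h : Perm ι)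
    (hW : ∀ i, h i ∈ W ↔ i ∈ W) : W.map (σ * h).toEmbedding = W.map σ.toEmbedding := by
  ext x
  rw [Finset.mem_map_equiv, Finset.mem_map_equiv]
  have := hW (h.symm (σ.symm x))
  rw [apply_symm_apply] at this
  exact this.symm

theorem map_mul_swap {ι : Type*} [DecidableEq ι] {W : Finset ι} (σ : Perm ι) {p q : ι}
    (hW : p ∈ W ↔ q ∈ W) : W.map (σ * swap p q).toEmbedding = W.map σ.toEmbedding := by
  apply map_mul_of_mem_iff
  intro i
  rw [swap_apply_def]
  split_ifs with h1 h2
  · subst h1; exact hW.symm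
  · subst h2; exact hW
  · exact Iff.rfl

variable {R : Type*} [CommRing R] {V : Type*} [AddCommGroup V] [Module R V]
  {A : Type*} [AddCommGroup A]

/-- `φ` computes, up to sign, the values of `ω` on the subfamilies of `l` of length `n` in terms
of the underlying set of indices. -/
def IsVolumeFunction {ι : Type*} (ω : V [⋀^Fin n]→ₗ[R] R) (l : ι → V)
    (φ : Finset ι → UnitGroup R) : Prop :=
  ∀ s : Fin n ↪ ι, EqUpToSign (toUnitGroup (ω (l ∘ s))) (φ (Finset.univ.map s))

theorem exists_isVolumeFunction {ι : Type*} (ω : V [⋀^Fin n]→ₗ[R] R) (l : ι → V) :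
    ∃ φ : Finset ι → UnitGroup R, IsVolumeFunction ω l φ := by
  classical
  refine ⟨fun S => if h : ∃ t : Fin n ↪ ι, Finset.univ.map t = S then
    toUnitGroup (ω (l ∘ h.choose)) else 0, fun s => ?_⟩
  have h : ∃ t : Fin n ↪ ι, Finset.univ.map t = Finset.univ.map s := ⟨s, rfl⟩
  simp only [dif_pos h]
  set t := h.choose
  have ht : Finset.univ.map t = Finset.univ.map s := h.choose_spec
  have h1 : ∀ j, ∃ i, t i = s j := by
    intro j
    have : s j ∈ Finset.univ.map t := by rw [ht]; simp
    simpa using this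
  choose π hπ using h1
  have hinj : Function.Injective π := by
    intro a b hab
    apply s.injective
    rw [← hπ, ← hπ, hab]
  have hs : l ∘ s = (l ∘ t) ∘ Equiv.ofBijective π (Finite.injective_iff_bijective.mp hinj) := by
    funext j
    simp [hπ]
  rw [hs]
  exact eqUpToSign_toUnitGroup_comp_perm _ _ _

/-- Twice the image of `Iₙ` under a linear map only depends on the values of `Δ` up to sign. -/
theorem two_smul_map_grassI {ω : V [⋀^Fin n]→ₗ[R] R} {l : Fin (2 * n) → V}
    {φ : Finset (Fin (2 * n)) → UnitGroup R} (hφ : IsVolumeFunction ω l φ)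
    (L : (⨂[ℤ]^n (UnitGroup R)) →ₗ[ℤ] A) :
    (2 : ℤ) • L (grassI ω l) = altSum (fun σ : Perm (Fin (2 * n)) =>
      twiceMultilinear L fun k => φ ((window n k).map σ.toEmbedding)) := by
  unfold grassI altSum
  rw [map_sum, Finset.smul_sum]
  refine Finset.sum_congr rfl fun σ _ => ?_
  rw [map_smul, smul_comm]
  congr 1
  rw [windowTensor, ← twiceMultilinear_apply]
  refine (killsSign_twiceMultilinear L).congr fun k => ?_
  have := hφ ((windowEmb n k).trans σ.toEmbedding)
  rw [← Finset.map_map, map_windowEmb] at this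
  exact this

end Windows

/-! ### Rescaling the vectors and the volume form -/

section Rescaling

variable {n : ℕ} {R : Type*} [CommRing R] {A : Type*} [AddCommGroup A]
  (T : MultilinearMap ℤ (fun _ : Fin n => UnitGroup R) A)

theorem altSum_update_eq_zero_of_swap (Φ : Fin n → Finset (Fin (2 * n)) → UnitGroup R) (k : Fin n)
    {θ : Perm (Fin (2 * n)) → UnitGroup R} {p q : Fin (2 * n)} (hpq : p ≠ q)
    (hW : ∀ j, j ≠ k → (p ∈ window n j ↔ q ∈ window n j)) (hθ : ∀ σ, θ (σ * swap p q) = θ σ) :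
    altSum (fun σ => T (Function.update
      (fun j => Φ j ((window n j).map σ.toEmbedding)) k (θ σ))) = 0 := by
  refine altSum_eq_zero_of_swap hpq fun σ => ?_
  rw [hθ]
  congr 1
  funext j
  by_cases hj : j = k
  · subst hj; simp
  · rw [Function.update_of_ne hj, Function.update_of_ne hj, map_mul_swap σ (hW j hj)]

/-- Only the `k`-th window separates the positions `k + n - 1` and `k + n`. -/
theorem altSum_update_const_eq_zero (Φ : Fin n → Finset (Fin (2 * n)) → UnitGroup R) (k : Fin n)
    (c : UnitGroup R) :
    altSum (fun σ : Perm (Fin (2 * n)) => T (Function.update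
      (fun j => Φ j ((window n j).map σ.toEmbedding)) k c)) = 0 := by
  refine altSum_update_eq_zero_of_swap T Φ k (p := ⟨k + n - 1, by omega⟩) (q := ⟨k + n, by omega⟩)
    ?_ ?_ (fun _ => rfl)
  · simp only [ne_eq, Fin.ext_iff]; omega
  · intro j hj
    have : (j : ℕ) ≠ k := fun h => hj (Fin.ext h)
    simp only [mem_window]
    omega

/-- The `k`-th window is the only one separating `k + n - 1` from `k + n`, and the only one
separating `k - 1` from `k` (cyclically). One of these two pairs avoids a given position `p` of
the window. -/
theorem altSum_update_apply_eq_zero (hn : 2 ≤ n) (Φ : Fin n → Finset (Fin (2 * n)) → UnitGroup R)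
    (k : Fin n) (a : Fin (2 * n) → UnitGroup R) {p : Fin (2 * n)} (hp : p ∈ window n k) :
    altSum (fun σ : Perm (Fin (2 * n)) => T (Function.update
      (fun j => Φ j ((window n j).map σ.toEmbedding)) k (a (σ p)))) = 0 := by
  rw [mem_window] at hp
  have key : ∀ x y : Fin (2 * n), x ≠ y → p ≠ x → p ≠ y →
      (∀ j : Fin n, (j : ℕ) ≠ k → (x ∈ window n j ↔ y ∈ window n j)) →
      altSum (fun σ : Perm (Fin (2 * n)) => T (Function.update
        (fun j => Φ j ((window n j).map σ.toEmbedding)) k (a (σ p)))) = 0 := by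
    intro x y hxy hx hy hW
    refine altSum_update_eq_zero_of_swap T Φ k hxy
      (fun j hj => hW j fun h => hj (Fin.ext h)) (fun σ => ?_)
    rw [Perm.mul_apply, swap_apply_of_ne_of_ne hx hy]
  by_cases h1 : (p : ℕ) = k + n - 1
  · by_cases h0 : (k : ℕ) = 0
    · refine key ⟨0, by omega⟩ ⟨2 * n - 1, by omega⟩ ?_ ?_ ?_ ?_
      · simp only [ne_eq, Fin.ext_iff]; omega
      · simp only [ne_eq, Fin.ext_iff]; omega
      · simp only [ne_eq, Fin.ext_iff]; omega
      · intro j hj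
        simp only [mem_window]
        omega
    · refine key ⟨k - 1, by omega⟩ ⟨k, by omega⟩ ?_ ?_ ?_ ?_
      · simp only [ne_eq, Fin.ext_iff]; omega
      · simp only [ne_eq, Fin.ext_iff]; omega
      · simp only [ne_eq, Fin.ext_iff]; omega
      · intro j hj
        simp only [mem_window]
        omega
  · refine key ⟨k + n - 1, by omega⟩ ⟨k + n, by omega⟩ ?_ ?_ ?_ ?_
    · simp only [ne_eq, Fin.ext_iff]; omega
    · simp only [ne_eq, Fin.ext_iff]; omega
    · simp only [ne_eq, Fin.ext_iff]; omega
    · intro j hj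
      simp only [mem_window]
      omega

/-- The alternating sum does not change if the volume form is multiplied by `c` and the vectors
by `a i`. -/
theorem altSum_window_congr {φ φ' : Finset (Fin (2 * n)) → UnitGroup R} (c : UnitGroup R)
    (a : Fin (2 * n) → UnitGroup R) (ha : 2 ≤ n ∨ a = 0)
    (h : ∀ S, φ' S = φ S + (c + ∑ i ∈ S, a i)) :
    altSum (fun σ : Perm (Fin (2 * n)) => T fun k => φ' ((window n k).map σ.toEmbedding)) =
    altSum (fun σ : Perm (Fin (2 * n)) => T fun k => φ ((window n k).map σ.toEmbedding)) := by
  let F : (Fin n → Finset (Fin (2 * n)) → UnitGroup R) → A := fun Φ =>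
    altSum (fun σ : Perm (Fin (2 * n)) => T fun k => Φ k ((window n k).map σ.toEmbedding))
  refine eq_of_forall_update F (fun _ => φ') (fun _ => φ) fun u k _ => ?_
  have hF : ∀ ψ, F (Function.update u k ψ) = altSum (fun σ : Perm (Fin (2 * n)) =>
      T (Function.update (fun j => u j ((window n j).map σ.toEmbedding)) k
        (ψ ((window n k).map σ.toEmbedding)))) := by
    intro ψ
    refine altSum_congr fun σ => ?_
    congr 1
    funext j
    by_cases hj : j = k
    · subst hj; simp
    · simp [Function.update_of_ne hj]
  rw [hF, hF]
  simp only [h, T.map_update_add]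
  rw [altSum_add, altSum_add, altSum_update_const_eq_zero, zero_add, add_eq_left]
  simp only [Finset.sum_map, T.map_update_sum]
  rw [altSum_sum]
  refine Finset.sum_eq_zero fun p hp => ?_
  rcases ha with hn | rfl
  · exact altSum_update_apply_eq_zero T hn u k a hp
  · simp only [Pi.zero_apply]
    exact altSum_update_const_eq_zero T u k 0

end Rescaling

/-! ### Volume forms -/

section VolumeForms

variable {n : ℕ} {R : Type*} [CommRing R] {V : Type*} [AddCommGroup V] [Module R V]
  {V' : Type*} [AddCommGroup V'] [Module R V']

/-- A volume form is invertible on every basis. -/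
theorem IsVolumeForm.isUnit_basis {ω : V [⋀^Fin n]→ₗ[R] R} (hω : IsVolumeForm ω)
    (b : Module.Basis (Fin n) R V) : IsUnit (ω b) := by
  have hb : IsGeneric R n (b : Fin n → V) := by
    intro s
    have : (b : Fin n → V) ∘ s = b.reindex (Equiv.ofBijective s
        (Finite.injective_iff_bijective.mp s.injective)).symm := by
      funext i; simp
    rw [this]
    exact ⟨Module.Basis.linearIndependent _, (Module.Basis.span_eq _).ge⟩
  exact isUnit_of_isGeneric hω hb (Function.Embedding.refl _)

/-- Two volume forms on isomorphic modules differ by a unit. -/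
theorem IsVolumeForm.exists_unit_smul {ω : V [⋀^Fin n]→ₗ[R] R} {ω' : V' [⋀^Fin n]→ₗ[R] R}
    (hω : IsVolumeForm ω) (hω' : IsVolumeForm ω') (g : V ≃ₗ[R] V') :
    ∃ c : Rˣ, ∀ v : Fin n → V, ω' (g ∘ v) = c * ω v := by
  obtain ⟨b, u, hu⟩ := hω
  obtain ⟨u', hu'⟩ := hω'.isUnit_basis (b.map g)
  refine ⟨u' * u⁻¹, fun v => ?_⟩
  have h1 := congrArg (fun f => f v) (AlternatingMap.eq_smul_basis_det b ω)
  have h2 := congrArg (fun f => f v)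
    (AlternatingMap.eq_smul_basis_det b (ω'.compLinearMap (g : V →ₗ[R] V')))
  simp only [AlternatingMap.smul_apply, smul_eq_mul, AlternatingMap.compLinearMap_apply] at h1 h2
  have h3 : (fun i => (g : V →ₗ[R] V') (b i)) = b.map g := by funext i; simp
  change ω' (g ∘ v) = ω' (fun i => (g : V →ₗ[R] V') (b i)) * _ at h2
  rw [h2, h1, h3, ← hu, ← hu', Units.val_mul, mul_assoc, ← mul_assoc (↑u⁻¹ : R), Units.inv_mul,
    one_mul]

/-- Rescaling the vectors of a family by units multiplies the volumes by units. -/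
theorem IsVolumeForm.exists_unit_rescale {ω : V [⋀^Fin n]→ₗ[R] R} {ω' : V' [⋀^Fin n]→ₗ[R] R}
    (hω : IsVolumeForm ω) (hω' : IsVolumeForm ω') {ι : Type*} {l : ι → V} {l' : ι → V'}
    (g : V ≃ₗ[R] V') (a : ι → Rˣ) (hl' : ∀ i, l' i = (a i : R) • g (l i)) :
    ∃ c : Rˣ, ∀ s : Fin n → ι, ω' (l' ∘ s) = ((∏ j, a (s j)) * c : Rˣ) * ω (l ∘ s) := by
  obtain ⟨c, hc⟩ := hω.exists_unit_smul hω' g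
  refine ⟨c, fun s => ?_⟩
  have : l' ∘ s = fun j => (a (s j) : R) • (g ∘ (l ∘ s)) j := by
    funext j; simp [hl']
  rw [this, ω'.map_smul_univ, hc, smul_eq_mul, Units.val_mul, Units.coe_prod, mul_assoc]

/-- A volume form on the quotient of `V` by the line spanned by `x` is, up to a unit, the
contraction of the volume form of `V` with `x`. -/
theorem IsVolumeForm.exists_unit_quotient {Ω : V [⋀^Fin (n + 1)]→ₗ[R] R} (hΩ : IsVolumeForm Ω)
    {x : V} (hx : ∀ r : R, r • x = 0 → r = 0)
    {ω : (V ⧸ Submodule.span R {x}) [⋀^Fin n]→ₗ[R] R} (hω : IsVolumeForm ω) :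
    ∃ c : Rˣ, ∀ v : Fin n → V,
      ω (fun i => Submodule.Quotient.mk (v i)) = c * Ω (Fin.cons x v : Fin (n + 1) → V) := by
  obtain ⟨b, u, hu⟩ := hω
  choose w hw using fun i => Submodule.Quotient.mk_surjective (Submodule.span R {x}) (b i)
  have hmkx : (Submodule.Quotient.mk x : V ⧸ Submodule.span R {x}) = 0 := by
    rw [Submodule.Quotient.mk_eq_zero]
    exact Submodule.mem_span_singleton_self x
  -- The vector `x` and lifts of a basis of the quotient form a basis of `V`.
  have hli : LinearIndependent R (Fin.cons x w : Fin (n + 1) → V) := by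
    rw [Fintype.linearIndependent_iff]
    intro g hg
    rw [Fin.sum_univ_succ] at hg
    simp only [Fin.cons_zero, Fin.cons_succ] at hg
    have h1 : ∀ i, g (Fin.succ i) = 0 := by
      refine Fintype.linearIndependent_iff.mp b.linearIndependent (fun i => g (Fin.succ i)) ?_
      have h2 := congrArg (Submodule.span R {x}).mkQ hg
      simp only [map_add, map_smul, map_sum, Submodule.mkQ_apply, hw, hmkx, smul_zero, zero_add,
        Submodule.Quotient.mk_zero] at h2
      exact h2
    simp only [h1, zero_smul, Finset.sum_const_zero, add_zero] at hg
    exact fun i => Fin.cases (hx _ hg) h1 i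
  have hspan : ⊤ ≤ Submodule.span R (Set.range (Fin.cons x w : Fin (n + 1) → V)) := by
    intro y _
    have hxmem : x ∈ Submodule.span R (Set.range (Fin.cons x w : Fin (n + 1) → V)) :=
      Submodule.subset_span ⟨0, rfl⟩
    have h1 := b.sum_repr (Submodule.Quotient.mk y)
    have h2 : y - ∑ i, b.repr (Submodule.Quotient.mk y) i • w i ∈ Submodule.span R {x} := by
      rw [← Submodule.Quotient.mk_eq_zero, ← Submodule.mkQ_apply]
      simp only [map_sub, map_sum, map_smul, Submodule.mkQ_apply, hw]
      rw [h1, sub_self]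
    rw [← sub_add_cancel y (∑ i, b.repr (Submodule.Quotient.mk y) i • w i)]
    refine add_mem (Submodule.span_le.mpr (by simpa using hxmem) h2) (sum_mem fun i _ => ?_)
    exact Submodule.smul_mem _ _ (Submodule.subset_span ⟨i.succ, by simp⟩)
  let c : Module.Basis (Fin (n + 1)) R V := Module.Basis.mk hli hspan
  have hc : (c : Fin (n + 1) → V) = Fin.cons x w := Module.Basis.coe_mk _ _
  obtain ⟨u', hu'⟩ := hΩ.isUnit_basis c
  rw [hc] at hu'
  refine ⟨u * u'⁻¹, fun v => ?_⟩
  -- Both sides are alternating forms in `v` which vanish if some `v i` equals `x`.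
  have key : ω.compLinearMap (Submodule.span R {x}).mkQ =
      ((u * u'⁻¹ : Rˣ) : R) • Ω.curryLeft x := by
    refine Module.Basis.ext_alternating c fun s hs => ?_
    simp only [AlternatingMap.compLinearMap_apply, AlternatingMap.smul_apply,
      AlternatingMap.curryLeft_apply_apply, smul_eq_mul, hc]
    by_cases h0 : ∃ i, s i = 0
    · obtain ⟨i, hi⟩ := h0
      rw [ω.map_coord_zero i, Ω.map_eq_zero_of_eq _ (i := 0) (j := i.succ) _
        (Fin.succ_ne_zero i).symm, mul_zero]
      · simp [hi, Matrix.vecCons]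
      · simp [hi, hmkx]
    · push Not at h0
      choose π hπ using fun i => Fin.exists_succ_eq.mpr (h0 i)
      have hinj : Function.Injective π := by
        intro a b hab
        apply hs
        rw [← hπ, ← hπ, hab]
      let e : Perm (Fin n) := Equiv.ofBijective π (Finite.injective_iff_bijective.mp hinj)
      have e1 : (fun i => (Submodule.span R {x}).mkQ ((Fin.cons x w : Fin (n + 1) → V) (s i))) =
          b ∘ e := by
        funext i
        simp [e, ← hπ, hw]
      have e2 : (fun i => (Fin.cons x w : Fin (n + 1) → V) (s i)) = w ∘ e := by
        funext i
        simp [e, ← hπ]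
      have e3 : Ω (Matrix.vecCons x (w ∘ e)) = Perm.sign e • Ω (Fin.cons x w) := by
        have := (Ω.curryLeft x).map_perm w e
        exact this
      rw [e1, e2, e3, ω.map_perm, ← hu, ← hu']
      rcases Int.units_eq_one_or (Perm.sign e) with h | h <;> simp [h]
  exact congrArg (fun f => f v) key

end VolumeForms

/-! ### Projective invariance and the two `(2n+1)`-term relations -/

section Relations

variable {n : ℕ} {R : Type*} [CommRing R] {V : Type*} [AddCommGroup V] [Module R V]
  {V' : Type*} [AddCommGroup V'] [Module R V']

theorem eqModTwoTorsion_iff {A : Type*} [AddCommGroup A] {x y : A} :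
    EqModTwoTorsion x y ↔ (2 : ℤ) • x = (2 : ℤ) • y := by
  rw [EqModTwoTorsion, smul_sub, sub_eq_zero]

theorem eqModTwoTorsion_grassI_smul (hn : 2 ≤ n) {ω : V [⋀^Fin n]→ₗ[R] R}
    {ω' : V' [⋀^Fin n]→ₗ[R] R} (hω : IsVolumeForm ω) (hω' : IsVolumeForm ω')
    {l : Fin (2 * n) → V} {l' : Fin (2 * n) → V'} (hl : IsGeneric R n l) (g : V ≃ₗ[R] V')
    (a : Fin (2 * n) → Rˣ) (hl' : ∀ i, l' i = (a i : R) • g (l i)) :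
    EqModTwoTorsion (grassI ω' l') (grassI ω l) := by
  obtain ⟨c, hc⟩ := hω.exists_unit_rescale hω' g a hl'
  obtain ⟨φ, hφ⟩ := exists_isVolumeFunction ω l
  have hφ' : IsVolumeFunction ω' l'
      (fun S => φ S + (Additive.ofMul c + ∑ i ∈ S, Additive.ofMul (a i))) := by
    intro s
    rw [hc, toUnitGroup_mul (Units.isUnit _) (isUnit_of_isGeneric hω hl s), toUnitGroup_coe,
      ofMul_mul, ofMul_prod]
    refine EqUpToSign.trans (EqUpToSign.add (.refl _) (hφ s)) (Or.inl ?_)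
    simp only [Finset.sum_map]
    abel
  rw [eqModTwoTorsion_iff]
  have e1 := two_smul_map_grassI hφ LinearMap.id
  have e2 := two_smul_map_grassI hφ' LinearMap.id
  simp only [LinearMap.id_apply] at e1 e2
  rw [e1, e2]
  exact altSum_window_congr _ _ _ (Or.inl hn) fun _ => rfl

/-- The sum is the alternating sum over all orderings of the `2n + 1` vectors of a function which
does not depend on the first and on the last vector. -/
theorem sum_grassI_succAbove (ω : V [⋀^Fin n]→ₗ[R] R) (hn : 1 ≤ n) (l : Fin (2 * n + 1) → V) :
    ∑ i : Fin (2 * n + 1), (-1 : ℤ) ^ ((i : ℕ) + 1) • grassI ω (l ∘ i.succAbove) = 0 := by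
  let F : (Fin (2 * n + 1) → Fin (2 * n + 1)) → ⨂[ℤ]^n (UnitGroup R) :=
    fun τ => windowTensor ω (l ∘ τ ∘ Fin.succ)
  have h1 : ∀ i : Fin (2 * n + 1), grassI ω (l ∘ i.succAbove) =
      altSum (fun σ : Perm (Fin (2 * n)) => F (Fin.cons i (i.succAbove ∘ σ))) := fun i => rfl
  simp only [h1, pow_succ, mul_neg_one, neg_smul]
  rw [Finset.sum_neg_distrib, sum_altSum_succAbove, neg_eq_zero]
  refine altSum_eq_zero_of_swap (p := 0) (q := Fin.last (2 * n)) ?_ fun τ => ?_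
  · rw [ne_eq, Fin.ext_iff]
    simp only [Fin.val_zero, Fin.val_last]
    omega
  · simp only [F, windowTensor]
    congr 1
    funext k
    congr 2
    funext j
    simp only [Function.comp_apply, Perm.mul_apply]
    rw [swap_apply_of_ne_of_ne (Fin.succ_ne_zero _)]
    rw [ne_eq, Fin.ext_iff]
    simp only [Fin.val_succ, Fin.val_last]
    omega

/-- The sum is the alternating sum over all orderings `v₀, …, v_{2n}` of the vectors of
`Δ(v₀, v₁, …, vₙ) ⊗ … ⊗ Δ(v₀, vₙ, …, v_{2n-1})`, every factor of which is symmetric up to sign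
in `v₀` and `vₙ`. -/
theorem eqModTwoTorsion_sum_grassI_project (hn : 1 ≤ n) (b : Module.Basis (Fin (n + 1)) R V)
    {m : Fin (2 * n + 1) → V} (hm : IsGeneric R (n + 1) m)
    {ω : ∀ j : Fin (2 * n + 1), (V ⧸ Submodule.span R {m j}) [⋀^Fin n]→ₗ[R] R}
    (hω : ∀ j, IsVolumeForm (ω j)) :
    EqModTwoTorsion
      (∑ j : Fin (2 * n + 1), (-1 : ℤ) ^ ((j : ℕ) + 1) • grassI (ω j) (project R m j)) 0 := by
  let Ω := b.det
  have hΩ : IsVolumeForm Ω := ⟨b, by simp [Ω, b.det_self]⟩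
  obtain ⟨ψ, hψ⟩ := exists_isVolumeFunction Ω m
  have hreg : ∀ j, ∀ r : R, r • m j = 0 → r = 0 := by
    intro j r hr
    let s : Fin (n + 1) ↪ Fin (2 * n + 1) :=
      (Fin.castLEEmb (by omega)).trans (swap 0 j).toEmbedding
    have hs : s 0 = j := by
      simp only [s, Function.Embedding.trans_apply]
      exact swap_apply_left 0 j
    have h1 := Fintype.linearIndependent_iff.mp (hm s).1 (Pi.single 0 r) (by
      rw [Finset.sum_eq_single 0]
      · simpa [hs] using hr
      · intro i _ hi; simp [hi]
      · simp) 0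
    simpa using h1
  choose c hc using fun j => hΩ.exists_unit_quotient (hreg j) (hω j)
  let T : MultilinearMap ℤ (fun _ : Fin n => UnitGroup R) (⨂[ℤ]^n (UnitGroup R)) :=
    twiceMultilinear LinearMap.id
  let F : (Fin (2 * n + 1) → Fin (2 * n + 1)) → ⨂[ℤ]^n (UnitGroup R) :=
    fun τ => T fun k => ψ ((insert 0 ((window n k).map (Fin.succEmb (2 * n)))).image τ)
  have h1 : ∀ j, (2 : ℤ) • grassI (ω j) (project R m j) =
      altSum (fun σ : Perm (Fin (2 * n)) => F (Fin.cons j (j.succAbove ∘ σ))) := by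
    intro j
    let φ : Finset (Fin (2 * n)) → UnitGroup R := fun S => ψ (insert j (S.map j.succAboveEmb))
    have hφ' : IsVolumeFunction (ω j) (project R m j)
        (fun S => φ S + (Additive.ofMul (c j) +
          ∑ i ∈ S, (0 : Fin (2 * n) → UnitGroup R) i)) := by
      intro s
      let t : Fin (n + 1) ↪ Fin (2 * n + 1) :=
        ⟨Fin.cons j (j.succAbove ∘ s), Fin.cons_injective_iff.mpr
          ⟨by rintro ⟨i, hi⟩; exact Fin.succAbove_ne _ _ hi,
            Fin.succAbove_right_injective.comp s.injective⟩⟩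
      have ht : m ∘ t = Fin.cons (m j) (fun i => m (j.succAbove (s i))) := by
        funext i
        refine Fin.cases rfl (fun i => ?_) i
        simp [t]
      have e1 : ω j (project R m j ∘ s) = c j * Ω (m ∘ t) := by
        rw [ht, ← hc]; rfl
      have e2 : Finset.univ.map t = insert j ((Finset.univ.map s).map j.succAboveEmb) := by
        ext i
        simp [t, Fin.exists_fin_succ, eq_comm]
      rw [e1, toUnitGroup_mul (c j).isUnit (isUnit_of_isGeneric hΩ hm t), toUnitGroup_coe]
      refine EqUpToSign.trans (EqUpToSign.add (.refl _) (hψ t)) (Or.inl ?_)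
      simp only [φ, e2, Pi.zero_apply, Finset.sum_const_zero, add_zero]
      abel
    have e1 := two_smul_map_grassI hφ' LinearMap.id
    simp only [LinearMap.id_apply] at e1
    rw [e1, altSum_window_congr (φ := φ) _ (Additive.ofMul (c j)) 0 (Or.inr rfl) fun _ => rfl]
    refine altSum_congr fun σ => ?_
    simp only [F, T, φ]
    congr 1
    funext k
    congr 1
    rw [Finset.image_insert, Fin.cons_zero, Finset.map_map, Finset.map_eq_image,
      Finset.map_eq_image, Finset.image_image]
    rfl
  rw [eqModTwoTorsion_iff, smul_zero, Finset.smul_sum]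
  simp only [pow_succ, mul_neg_one, neg_smul, smul_neg, smul_comm (2 : ℤ), h1]
  rw [Finset.sum_neg_distrib, sum_altSum_succAbove, neg_eq_zero]
  refine altSum_eq_zero_of_swap (p := 0) (q := (⟨n - 1, by omega⟩ : Fin (2 * n)).succ)
    (Fin.succ_ne_zero _).symm fun τ => ?_
  simp only [F]
  congr 1
  funext k
  congr 1
  have := map_mul_swap (W := insert 0 ((window n k).map (Fin.succEmb (2 * n)))) τ (p := 0)
    (q := (⟨n - 1, by omega⟩ : Fin (2 * n)).succ) (iff_of_true (Finset.mem_insert_self _ _) ?_)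
  · exact (Finset.map_eq_image _ _).symm.trans (this.trans (Finset.map_eq_image _ _))
  · refine Finset.mem_insert_of_mem (Finset.mem_map.mpr ⟨⟨n - 1, by omega⟩, ?_, rfl⟩)
    rw [mem_window]
    simp only
    omega

end Relations

/-! ### The Steinberg relation -/

section Steinberg

variable {F : Type*} [Field F] {A : Type*} [AddCommGroup A]

/-- A bilinear map on `F^*` satisfying the Steinberg relation and vanishing on `-1` in either
argument: a symbol, insensitive to signs. -/
structure IsSteinbergSymbol (B : UnitGroup F →ₗ[ℤ] UnitGroup F →ₗ[ℤ] A) : Prop where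
  steinberg : ∀ a b : Fˣ, (a : F) + b = 1 → B (Additive.ofMul a) (Additive.ofMul b) = 0
  neg_one_left : ∀ y, B (Additive.ofMul (-1)) y = 0
  neg_one_right : ∀ x, B x (Additive.ofMul (-1)) = 0

namespace IsSteinbergSymbol

variable {B : UnitGroup F →ₗ[ℤ] UnitGroup F →ₗ[ℤ] A}

theorem congr (hB : IsSteinbergSymbol B) {x y x' y' : UnitGroup F} (h : EqUpToSign x x')
    (h' : EqUpToSign y y') : B x y = B x' y' := by
  rcases h with rfl | rfl <;> rcases h' with rfl | rfl <;>
    simp [hB.neg_one_left, hB.neg_one_right]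

/-- The relation `{a, -a} = 0`, from `-a = (1 - a) / (1 - a⁻¹)`. -/
theorem self_eq_zero (hB : IsSteinbergSymbol B) (x : UnitGroup F) : B x x = 0 := by
  obtain ⟨a, rfl⟩ := Additive.ofMul.surjective x
  by_cases ha : a = 1
  · subst ha; simp
  have ha' : (a : F) ≠ 1 := fun h => ha (Units.ext h)
  have h0 : (a : F) ≠ 0 := a.ne_zero
  let b : Fˣ := Units.mk0 (1 - a) (sub_ne_zero.mpr ha'.symm)
  let c : Fˣ := Units.mk0 (1 - (a : F)⁻¹) (sub_ne_zero.mpr (by simpa [eq_comm] using ha'))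
  have hb := hB.steinberg a b (by simp [b])
  have hc := hB.steinberg a⁻¹ c (by simp [c])
  have hbc : b = (-1) * a * c := by
    ext
    simp only [b, c, Units.val_mk0, Units.val_mul, Units.val_neg, Units.val_one]
    field_simp
    ring
  rw [hbc, ofMul_mul, ofMul_mul, map_add, map_add, hB.neg_one_right, zero_add] at hb
  rw [ofMul_inv, map_neg, LinearMap.neg_apply, neg_eq_zero] at hc
  rwa [hc, add_zero] at hb

end IsSteinbergSymbol

/-- A three-term relation `P + R = Q` between units gives a relation between symbols. -/
theorem IsSteinbergSymbol.three_term {B : UnitGroup F →ₗ[ℤ] UnitGroup F →ₗ[ℤ] A}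
    (hB : IsSteinbergSymbol B) {P Q R : Fˣ} (h : (P : F) + R = Q) {p q r : UnitGroup F}
    (hp : EqUpToSign (Additive.ofMul P) p) (hq : EqUpToSign (Additive.ofMul Q) q)
    (hr : EqUpToSign (Additive.ofMul R) r) :
    B p q + B q r + B r p = 0 := by
  have h1 := hB.steinberg (P * Q⁻¹) (R * Q⁻¹) (by
    rw [Units.val_mul, Units.val_mul, ← add_mul, h, Units.mul_inv])
  have hanti : ∀ x y, B x y = -B y x := by
    intro x y
    have := hB.self_eq_zero (x + y)
    rw [map_add, map_add, LinearMap.add_apply, LinearMap.add_apply, hB.self_eq_zero,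
      hB.self_eq_zero, zero_add, add_zero] at this
    exact eq_neg_of_add_eq_zero_right this
  rw [← hB.congr hp hq, ← hB.congr hq hr, ← hB.congr hr hp]
  rw [ofMul_mul, ofMul_mul, ofMul_inv, map_add, map_add, LinearMap.add_apply, LinearMap.add_apply,
    map_neg, map_neg, map_neg, LinearMap.neg_apply, LinearMap.neg_apply, hB.self_eq_zero,
    neg_zero, neg_zero, add_zero, hanti (Additive.ofMul P) (Additive.ofMul R)] at h1
  rw [← neg_eq_zero, ← h1]
  abel

end Steinberg

/-! ### The three-term Plücker relation -/

section Pluecker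

/-- The three-term Plücker relation between the values of an alternating form on the families
`x, y, e₂, …, e_{m+1}`, where `x` and `y` are among `e₀, e₁, u, v`. -/
theorem three_term_pluecker {R : Type*} [CommRing R] {V : Type*} [AddCommGroup V] [Module R V]
    {m : ℕ} (ω : V [⋀^Fin (m + 2)]→ₗ[R] R) (e : Module.Basis (Fin (m + 2)) R V) (u v : V)
    {g : V → V → R} (hg : ∀ x y, g x y = ω (Matrix.vecCons x (Matrix.vecCons y
      (fun i : Fin m => e i.succ.succ)))) :
    g (e 0) (e 1) * g u v + g (e 0) v * g (e 1) u = g (e 0) u * g (e 1) v := by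
  let G : V →ₗ[R] V →ₗ[R] R := LinearMap.mk₂ R g
    (fun x y z => by simp only [hg]; exact ω.map_vecCons_add _ _ _)
    (fun c x y => by simp only [hg]; exact ω.map_vecCons_smul _ _ _)
    (fun x y z => by
      have := (ω.curryLeft x).map_vecCons_add (fun i : Fin m => e i.succ.succ) y z
      simp only [hg]
      exact this)
    (fun c x y => by
      have := (ω.curryLeft x).map_vecCons_smul (fun i : Fin m => e i.succ.succ) c y
      simp only [hg]
      exact this)
  have hG : ∀ x y, g x y = G x y := fun _ _ => rfl
  have hself : ∀ x, G x x = 0 := by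
    intro x
    rw [← hG, hg]
    exact ω.map_eq_zero_of_eq _ (i := 0) (j := 1) (by simp) (by simp)
  have hanti : ∀ x y, G x y = -G y x := by
    intro x y
    have := hself (x + y)
    rw [map_add, map_add, LinearMap.add_apply, LinearMap.add_apply, hself, hself, zero_add,
      add_zero] at this
    exact eq_neg_of_add_eq_zero_right this
  have hzero : ∀ i x, G (e (Fin.succ (Fin.succ i))) x = 0 := by
    intro i x
    rw [← hG, hg]
    exact ω.map_eq_zero_of_eq _ (i := 0) (j := i.succ.succ) (by simp)
      (Fin.succ_ne_zero _).symm
  have hexp : ∀ x y, G x y = e.repr x 0 * G (e 0) y + e.repr x 1 * G (e 1) y := by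
    intro x y
    conv_lhs => rw [← e.sum_repr x]
    rw [Fin.sum_univ_succ, Fin.sum_univ_succ]
    simp only [map_add, map_sum, map_smul, LinearMap.add_apply, LinearMap.sum_apply,
      LinearMap.smul_apply, hzero, smul_eq_mul, mul_zero, Finset.sum_const_zero, add_zero]
    rfl
  simp only [hG]
  rw [hexp u v, hanti (e 0) v, hanti (e 1) v, hanti (e 0) u, hanti (e 1) u,
    hexp v (e 0), hexp v (e 1), hexp u (e 0), hexp u (e 1), hself, hself, hanti (e 1) (e 0)]
  ring

variable {K : Type*} [Field K] {V : Type*} [AddCommGroup V] [Module K V] {n : ℕ}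
  {A : Type*} [AddCommGroup A]

/-- The Steinberg relation attached to the Plücker relation for the vectors with indices `x 0`,
`x 1`, `x 2`, `x 3` in the quotient by the span of the vectors with indices in `S`. -/
theorem IsVolumeFunction.symbol_relation {ι : Type*} [DecidableEq ι] {ω : V [⋀^Fin n]→ₗ[K] K}
    (hω : IsVolumeForm ω) {l : ι → V} (hl : IsGeneric K n l) {φ : Finset ι → UnitGroup K}
    (hφ : IsVolumeFunction ω l φ) {B : UnitGroup K →ₗ[ℤ] UnitGroup K →ₗ[ℤ] A}
    (hB : IsSteinbergSymbol B) {S : Finset ι} (hS : S.card + 2 = n) {x : Fin 4 → ι}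
    (hx : Function.Injective x) (hxS : ∀ i, x i ∉ S) {d : Fin 4 → Fin 4 → UnitGroup K}
    (hd : ∀ i j, d i j = φ (insert (x i) (insert (x j) S))) :
    B (d 0 1 + d 2 3) (d 0 2 + d 1 3) + B (d 0 2 + d 1 3) (d 1 2 + d 0 3) +
      B (d 1 2 + d 0 3) (d 0 1 + d 2 3) = 0 := by
  subst hS
  let s : Fin S.card ↪ ι := S.equivFin.symm.toEmbedding.trans (Function.Embedding.subtype _)
  have hs : Finset.univ.map s = S := by
    ext i
    simp only [s, Finset.mem_map, Finset.mem_univ, true_and, Function.Embedding.trans_apply,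
      Equiv.coe_toEmbedding, Function.Embedding.subtype_apply]
    exact ⟨fun ⟨a, ha⟩ => ha ▸ (S.equivFin.symm a).2, fun h => ⟨S.equivFin ⟨i, h⟩, by simp⟩⟩
  have hsmem : ∀ a, s a ∈ S := fun a => (S.equivFin.symm a).2
  let t : ∀ i j, i ≠ j → (Fin (S.card + 2) ↪ ι) := fun i j hij =>
    ⟨Matrix.vecCons (x i) (Matrix.vecCons (x j) s), by
      refine Fin.cons_injective_iff.mpr ⟨?_, Fin.cons_injective_iff.mpr ⟨?_, s.injective⟩⟩
      · rintro ⟨a, ha⟩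
        revert ha
        refine Fin.cases (fun ha => ?_) (fun a ha => ?_) a
        · exact hij (hx ha.symm)
        · exact hxS i (ha ▸ hsmem a)
      · rintro ⟨a, ha⟩
        exact hxS j (ha ▸ hsmem a)⟩
  have ht : ∀ i j (h : i ≠ j), Finset.univ.map (t i j h) = insert (x i) (insert (x j) S) := by
    intro i j h
    ext a
    have := congrArg (a ∈ ·) hs
    simp only [Finset.mem_map, Finset.mem_univ, true_and, eq_iff_iff] at this
    simp only [Finset.mem_map, Finset.mem_univ, true_and, Fin.exists_fin_succ,
      Finset.mem_insert, ← this]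
    exact or_congr eq_comm (or_congr eq_comm Iff.rfl)
  let g : V → V → K := fun y z => ω (Matrix.vecCons y (Matrix.vecCons z (l ∘ s)))
  have hlt : ∀ i j (h : i ≠ j),
      l ∘ t i j h = Matrix.vecCons (l (x i)) (Matrix.vecCons (l (x j)) (l ∘ s)) := by
    intro i j h
    funext a
    refine Fin.cases rfl (fun a => Fin.cases rfl (fun a => rfl) a) a
  have hu : ∀ i j, i ≠ j → ∃ u : Kˣ, (u : K) = g (l (x i)) (l (x j)) ∧
      EqUpToSign (Additive.ofMul u) (d i j) := by
    intro i j h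
    obtain ⟨u, hu⟩ := isUnit_of_isGeneric hω hl (t i j h)
    have h1 := hφ (t i j h)
    rw [← hu, toUnitGroup_coe, ht i j h, ← hd] at h1
    exact ⟨u, by rw [hu, hlt i j h], h1⟩
  obtain ⟨u01, e01, h01⟩ := hu 0 1 (by decide)
  obtain ⟨u23, e23, h23⟩ := hu 2 3 (by decide)
  obtain ⟨u02, e02, h02⟩ := hu 0 2 (by decide)
  obtain ⟨u13, e13, h13⟩ := hu 1 3 (by decide)
  obtain ⟨u12, e12, h12⟩ := hu 1 2 (by decide)
  obtain ⟨u03, e03, h03⟩ := hu 0 3 (by decide)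
  refine hB.three_term (P := u01 * u23) (Q := u02 * u13) (R := u12 * u03) ?_
    (h01.add h23) (h02.add h13) (h12.add h03)
  let e : Module.Basis (Fin (S.card + 2)) K V :=
    Module.Basis.mk (hl (t 0 1 (by decide))).1 (hl (t 0 1 (by decide))).2
  have he : (e : Fin (S.card + 2) → V) =
      Matrix.vecCons (l (x 0)) (Matrix.vecCons (l (x 1)) (l ∘ s)) :=
    (Module.Basis.coe_mk _ _).trans (hlt 0 1 (by decide))
  have hp := three_term_pluecker ω e (l (x 2)) (l (x 3)) (g := g) (by
    intro y z
    simp only [g, he]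
    rfl)
  have he0 : e 0 = l (x 0) := congrFun he 0
  have he1 : e 1 = l (x 1) := congrFun he 1
  rw [he0, he1] at hp
  simp only [Units.val_mul, e01, e23, e02, e13, e12, e03]
  rw [← hp]
  ring

end Pluecker

/-! ### Alternating sums of symbols -/

section SymbolSums

variable {G : Type*} [AddCommGroup G] {A : Type*} [AddCommGroup A]

theorem altSum_fin_two (F : (Fin 2 → Fin 2) → A) :
    altSum (fun σ : Perm (Fin 2) => F σ) = F ![0, 1] - F ![1, 0] := by
  unfold altSum
  rw [show (Finset.univ : Finset (Perm (Fin 2))) = {1, swap 0 1} by decide]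
  rw [Finset.sum_pair (by decide)]
  have h0 : ((1 : Perm (Fin 2)) : Fin 2 → Fin 2) = ![0, 1] := by decide
  have h1 : (swap (0 : Fin 2) 1 : Fin 2 → Fin 2) = ![1, 0] := by decide
  simp only [h0, h1]
  rw [Perm.sign_one, Perm.sign_swap (by decide)]
  simp [sub_eq_add_neg]

theorem altSum_fin_three (F : (Fin 3 → Fin 3) → A) :
    altSum (fun σ : Perm (Fin 3) => F σ) =
      F ![0, 1, 2] - F ![0, 2, 1] - F ![1, 0, 2] + F ![1, 2, 0] + F ![2, 0, 1] - F ![2, 1, 0] := by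
  rw [← sum_altSum_succAbove, Fin.sum_univ_three]
  have h : ∀ i : Fin 3, altSum (fun σ : Perm (Fin 2) => F (Fin.cons i (i.succAbove ∘ σ))) =
      F (Fin.cons i (i.succAbove ∘ ![0, 1])) - F (Fin.cons i (i.succAbove ∘ ![1, 0])) :=
    fun i => altSum_fin_two fun τ => F (Fin.cons i (i.succAbove ∘ τ))
  have e1 : (Fin.cons 0 (Fin.succAbove 0 ∘ ![0, 1]) : Fin 3 → Fin 3) = ![0, 1, 2] := by decide
  have e2 : (Fin.cons 0 (Fin.succAbove 0 ∘ ![1, 0]) : Fin 3 → Fin 3) = ![0, 2, 1] := by decide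
  have e3 : (Fin.cons 1 (Fin.succAbove 1 ∘ ![0, 1]) : Fin 3 → Fin 3) = ![1, 0, 2] := by decide
  have e4 : (Fin.cons 1 (Fin.succAbove 1 ∘ ![1, 0]) : Fin 3 → Fin 3) = ![1, 2, 0] := by decide
  have e5 : (Fin.cons 2 (Fin.succAbove 2 ∘ ![0, 1]) : Fin 3 → Fin 3) = ![2, 0, 1] := by decide
  have e6 : (Fin.cons 2 (Fin.succAbove 2 ∘ ![1, 0]) : Fin 3 → Fin 3) = ![2, 1, 0] := by decide
  rw [h, h, h, e1, e2, e3, e4, e5, e6]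
  simp
  abel

/-- In `K₂`, the alternating sum of `{|x₀x₁|, |x₁x₂|}` over the orderings of four vectors in the
plane is `-2` times the Steinberg relation given by the Plücker relation. -/
theorem altSum_fin_four_symbol (B : G →ₗ[ℤ] G →ₗ[ℤ] A) (hB : ∀ x, B x x = 0)
    (d : Fin 4 → Fin 4 → G) (hd : ∀ i j, d i j = d j i)
    (h : B (d 0 1 + d 2 3) (d 0 2 + d 1 3) + B (d 0 2 + d 1 3) (d 1 2 + d 0 3) +
      B (d 1 2 + d 0 3) (d 0 1 + d 2 3) = 0) :
    altSum (fun σ : Perm (Fin 4) => B (d (σ 0) (σ 1)) (d (σ 1) (σ 2))) = 0 := by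
  have hanti : ∀ x y, B x y = -B y x := by
    intro x y
    have := hB (x + y)
    rw [map_add, map_add, LinearMap.add_apply, LinearMap.add_apply, hB, hB, zero_add,
      add_zero] at this
    exact eq_neg_of_add_eq_zero_right this
  let F : (Fin 4 → Fin 4) → A := fun τ => B (d (τ 0) (τ 1)) (d (τ 1) (τ 2))
  have h3 := fun i : Fin 4 => altSum_fin_three fun τ => F (Fin.cons i (i.succAbove ∘ τ))
  change altSum (fun σ : Perm (Fin 4) => F σ) = 0
  rw [← sum_altSum_succAbove, Fin.sum_univ_four, h3, h3, h3, h3]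
  have c2 : ∀ (i : Fin 4) (f : Fin 3 → Fin 4), (Fin.cons i f : Fin 4 → Fin 4) 2 = f 1 :=
    fun _ _ => rfl
  simp only [F, Fin.cons_zero, Fin.cons_one, c2, Function.comp_apply]
  simp only [map_add, LinearMap.add_apply] at h
  simp [Fin.succAbove, Fin.lt_def]
  rw [hd 1 0, hd 2 0, hd 3 0, hd 2 1, hd 3 1, hd 3 2]
  rw [hanti (d 0 2) (d 0 1), hanti (d 0 3) (d 0 1), hanti (d 1 2) (d 0 1), hanti (d 1 3) (d 0 1),
    hanti (d 0 3) (d 0 2), hanti (d 1 2) (d 0 2), hanti (d 2 3) (d 0 2), hanti (d 1 3) (d 0 3),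
    hanti (d 2 3) (d 0 3), hanti (d 1 3) (d 1 2), hanti (d 2 3) (d 1 2), hanti (d 2 3) (d 1 3)]
  rw [hanti (d 0 3) (d 0 1), hanti (d 1 2) (d 0 1), hanti (d 2 3) (d 0 2), hanti (d 1 3) (d 1 2),
    hanti (d 1 3) (d 0 3), hanti (d 2 3) (d 1 3)] at h
  linear_combination (norm := module) (-2 : ℤ) • h

/-- In `K₂`, the alternating sum of `{|x₁ x₂ y₀|, |x₂ y₀ y₁|}` over the orderings of `x₀, x₁, x₂`
and of `y₀, y₁, y₂` vanishes, for six vectors in three-dimensional space. For fixed `i = x₂` and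
`j = x₁`, the Plücker relation in the quotient by `x₂` shows that the sum over the orderings of
`y₀, y₁, y₂` is a sum of a term depending only on `i` and a term symmetric in `i` and `j`. -/
theorem altSum_fin_three_symbol (B : G →ₗ[ℤ] G →ₗ[ℤ] A) (hB : ∀ x, B x x = 0)
    (u v : Fin 3 → Fin 3 → Fin 3 → G) (hu : ∀ i j k, u i j k = u j i k)
    (hv : ∀ i j k, v i j k = v i k j)
    (h : ∀ i j, i ≠ j →
      B (v i 0 1 + u i j 2) (v i 0 2 + u i j 1) + B (v i 0 2 + u i j 1) (v i 1 2 + u i j 0) +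
        B (v i 1 2 + u i j 0) (v i 0 1 + u i j 2) = 0) :
    altSum (fun σ : Perm (Fin 3) => altSum fun τ : Perm (Fin 3) =>
      B (u (σ 1) (σ 2) (τ 0)) (v (σ 2) (τ 0) (τ 1))) = 0 := by
  have hanti : ∀ x y, B x y = -B y x := by
    intro x y
    have := hB (x + y)
    rw [map_add, map_add, LinearMap.add_apply, LinearMap.add_apply, hB, hB, zero_add,
      add_zero] at this
    exact eq_neg_of_add_eq_zero_right this
  let Y : Fin 3 → A := fun i =>
    B (v i 0 2) (v i 0 1) + B (v i 1 2) (v i 0 2) + B (v i 0 1) (v i 1 2)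
  let X : Fin 3 → Fin 3 → A := fun i j =>
    B (u i j 1) (u i j 2) + B (u i j 0) (u i j 1) + B (u i j 2) (u i j 0)
  have key : ∀ i j, i ≠ j → altSum (fun τ : Perm (Fin 3) => B (u j i (τ 0)) (v i (τ 0) (τ 1))) =
      Y i + X i j := by
    intro i j hij
    have h1 := h i j hij
    rw [altSum_fin_three fun τ => B (u j i (τ 0)) (v i (τ 0) (τ 1))]
    simp only [Matrix.cons_val_zero, Matrix.cons_val_one, hu j i, Y, X]
    simp only [map_add, LinearMap.add_apply] at h1
    rw [hv i 1 0, hv i 2 0, hv i 2 1]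
    rw [hanti (v i 0 1) (u i j 1), hanti (v i 0 2) (u i j 0), hanti (v i 1 2) (u i j 2),
      hanti (v i 0 1) (v i 0 2), hanti (v i 0 2) (v i 1 2), hanti (v i 1 2) (v i 0 1),
      hanti (u i j 2) (u i j 1), hanti (u i j 1) (u i j 0), hanti (u i j 0) (u i j 2)] at h1
    linear_combination (norm := module) h1
  rw [altSum_congr (E' := fun σ : Perm (Fin 3) => Y (σ 2) + X (σ 2) (σ 1)) fun σ =>
    key _ _ (σ.injective.ne (by decide)), altSum_add,
    altSum_eq_zero_of_swap (p := 0) (q := 1) (by decide),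
    altSum_eq_zero_of_swap (p := 1) (q := 2) (by decide), add_zero]
  · intro σ
    simp [Perm.mul_apply, X, hu (σ 1)]
  · intro σ
    simp only [Perm.mul_apply]
    rw [swap_apply_of_ne_of_ne (by decide) (by decide)]

end SymbolSums

/-! ### The projections to `K₂` -/

section PiK2

variable {F : Type*} [Field F]

theorem mulEquiv_symm_tprod {M : Type*} [AddCommGroup M] {n m : ℕ} (v : Fin (n + m) → M) :
    (TensorPower.mulEquiv (R := ℤ) (M := M) (n := n) (m := m)).symm (PiTensorProduct.tprod ℤ v) =
      PiTensorProduct.tprod ℤ (fun i => v (Fin.castAdd m i)) ⊗ₜ[ℤ]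
        PiTensorProduct.tprod ℤ (fun i => v (Fin.natAdd n i)) := by
  rw [LinearEquiv.symm_apply_eq]
  have := TensorPower.tprod_mul_tprod ℤ (fun i => v (Fin.castAdd m i))
    (fun i => v (Fin.natAdd n i))
  rw [TensorPower.gMul_def] at this
  rw [this]
  congr 1
  exact (Fin.append_castAdd_natAdd (f := v)).symm

theorem piK2_tprod (p q : ℕ) (v : Fin (p + 2 + q) → UnitGroup F) :
    piK2 F p q (PiTensorProduct.tprod ℤ v) =
      (PiTensorProduct.tprod ℤ (fun i => v (Fin.castAdd q (Fin.castAdd 2 i))) ⊗ₜ[ℤ]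
        (steinberg F).mkQ (PiTensorProduct.tprod ℤ (fun i => v (Fin.castAdd q (Fin.natAdd p i)))))
        ⊗ₜ[ℤ] PiTensorProduct.tprod ℤ (fun i => v (Fin.natAdd (p + 2) i)) := by
  have e1 := mulEquiv_symm_tprod (n := p + 2) (m := q) v
  have e2 := mulEquiv_symm_tprod (n := p) (m := 2) fun i => v (Fin.castAdd q i)
  have e3 : piK2 F p q (PiTensorProduct.tprod ℤ v) =
      TensorProduct.map (TensorProduct.map LinearMap.id (steinberg F).mkQ) LinearMap.id
        (TensorProduct.map (TensorPower.mulEquiv (R := ℤ) (M := UnitGroup F) (n := p)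
          (m := 2)).symm.toLinearMap LinearMap.id
          (TensorPower.mulEquiv.symm (PiTensorProduct.tprod ℤ v))) := rfl
  rw [e3, e1, TensorProduct.map_tmul, LinearEquiv.coe_coe, e2]
  rfl

/-- The positions of the factor `K₂`. -/
def symbolPos (p q : ℕ) (i : Fin 2) : Fin (p + 2 + q) := Fin.castAdd q (Fin.natAdd p i)

theorem symbolPos_val (p q : ℕ) (i : Fin 2) : (symbolPos p q i : ℕ) = p + i := rfl

theorem symbolPos_ne (p q : ℕ) : symbolPos p q 0 ≠ symbolPos p q 1 := by
  simp [Fin.ext_iff, symbolPos_val]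

theorem piK2_tprod_eq_zero (p q : ℕ) (v : Fin (p + 2 + q) → UnitGroup F) {a b : Fˣ}
    (hab : (a : F) + b = 1) (ha : v (symbolPos p q 0) = Additive.ofMul a)
    (hb : v (symbolPos p q 1) = Additive.ofMul b) :
    piK2 F p q (PiTensorProduct.tprod ℤ v) = 0 := by
  have h : (steinberg F).mkQ
      (PiTensorProduct.tprod ℤ (fun i => v (Fin.castAdd q (Fin.natAdd p i)))) = 0 := by
    rw [Submodule.mkQ_apply, Submodule.Quotient.mk_eq_zero]
    refine Submodule.subset_span ⟨a, b, hab, ?_⟩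
    congr 1
    funext i
    fin_cases i
    · exact ha
    · exact hb
  rw [piK2_tprod, h, TensorProduct.tmul_zero, TensorProduct.zero_tmul]

/-- Twice the projection `π`, as a bilinear map in the two factors going to `K₂`, the other factors
being those of `v`. -/
def symbolForm (p q : ℕ) (v : Fin (p + 2 + q) → UnitGroup F) :
    UnitGroup F →ₗ[ℤ] UnitGroup F →ₗ[ℤ]
      ((⨂[ℤ]^p (UnitGroup F)) ⊗[ℤ] K2 F) ⊗[ℤ] (⨂[ℤ]^q (UnitGroup F)) :=
  LinearMap.mk₂ ℤ
    (fun x y => twiceMultilinear (piK2 F p q)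
      (Function.update (Function.update v (symbolPos p q 0) x) (symbolPos p q 1) y))
    (fun x x' y => by
      simp only [Function.update_comm (symbolPos_ne p q), MultilinearMap.map_update_add])
    (fun c x y => by
      simp only [Function.update_comm (symbolPos_ne p q), MultilinearMap.map_update_smul])
    (fun x y y' => MultilinearMap.map_update_add _ _ _ _ _)
    (fun c x y => MultilinearMap.map_update_smul _ _ _ _ _)

theorem symbolForm_apply (p q : ℕ) (v : Fin (p + 2 + q) → UnitGroup F) (x y : UnitGroup F) :
    symbolForm p q v x y = twiceMultilinear (piK2 F p q)
      (Function.update (Function.update v (symbolPos p q 0) x) (symbolPos p q 1) y) := rfl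

theorem isSteinbergSymbol_symbolForm (p q : ℕ) (v : Fin (p + 2 + q) → UnitGroup F) :
    IsSteinbergSymbol (symbolForm p q v) where
  steinberg a b hab := by
    rw [symbolForm_apply, twiceMultilinear_apply, piK2_tprod_eq_zero p q _ hab, smul_zero]
    · rw [Function.update_of_ne (symbolPos_ne p q), Function.update_self]
    · rw [Function.update_self]
  neg_one_left y := by
    rw [symbolForm_apply, Function.update_comm (symbolPos_ne p q)]
    exact killsSign_twiceMultilinear _ _ _
  neg_one_right x := killsSign_twiceMultilinear _ _ _

theorem twiceMultilinear_piK2_eq (p q : ℕ) {v w : Fin (p + 2 + q) → UnitGroup F}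
    (h : ∀ k, k ≠ symbolPos p q 0 → k ≠ symbolPos p q 1 → v k = w k) :
    twiceMultilinear (piK2 F p q) v =
      symbolForm p q w (v (symbolPos p q 0)) (v (symbolPos p q 1)) := by
  rw [symbolForm_apply]
  congr 1
  funext k
  by_cases h1 : k = symbolPos p q 1
  · subst h1; simp
  · rw [Function.update_of_ne h1]
    by_cases h0 : k = symbolPos p q 0
    · subst h0; simp
    · rw [Function.update_of_ne h0, h k h0 h1]

end PiK2

/-! ### Integrability -/

section Integrability

/-- The positions `p - 1, p, p + 1` (modulo `2n`), which only the windows `p` and `p + 1`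
separate, and the positions `p + n - 1, p + n, p + n + 1`, for which the same holds. -/
def swapPos (n p : ℕ) (hp : p + 2 ≤ n) : Fin 3 ⊕ Fin 3 → Fin (2 * n)
  | Sum.inl i => if p + i = 0 then ⟨2 * n - 1, by omega⟩ else ⟨p + i - 1, by omega⟩
  | Sum.inr i => ⟨p + n - 1 + i, by omega⟩

theorem swapPos_inl_val (n p : ℕ) (hp : p + 2 ≤ n) (i : Fin 3) :
    (swapPos n p hp (Sum.inl i) : ℕ) = if p + i = 0 then 2 * n - 1 else p + i - 1 := by
  simp only [swapPos]
  split_ifs <;> rfl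

theorem swapPos_inr_val (n p : ℕ) (hp : p + 2 ≤ n) (i : Fin 3) :
    (swapPos n p hp (Sum.inr i) : ℕ) = p + n - 1 + i := rfl

theorem swapPos_injective (n p : ℕ) (hp : p + 2 ≤ n) (hn : 3 ≤ n) :
    Function.Injective (swapPos n p hp) := by
  rintro (i | i) (j | j) h <;>
    simp only [Fin.ext_iff, swapPos_inl_val, swapPos_inr_val] at h
  · congr 1; ext; split_ifs at h <;> omega
  · exfalso; split_ifs at h <;> omega
  · exfalso; split_ifs at h <;> omega
  · congr 1; ext; omega

/-- The permutations of the positions `swapPos` preserving the two triples. -/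
noncomputable def swapHom (n p : ℕ) (hp : p + 2 ≤ n) (hn : 3 ≤ n) :
    Perm (Fin 3) × Perm (Fin 3) →* Perm (Fin (2 * n)) :=
  (Perm.viaEmbeddingHom ⟨swapPos n p hp, swapPos_injective n p hp hn⟩).comp
    (Perm.sumCongrHom (Fin 3) (Fin 3))

theorem swapHom_injective (n p : ℕ) (hp : p + 2 ≤ n) (hn : 3 ≤ n) :
    Function.Injective (swapHom n p hp hn) :=
  (Perm.viaEmbeddingHom_injective _).comp Perm.sumCongrHom_injective

theorem sign_swapHom (n p : ℕ) (hp : p + 2 ≤ n) (hn : 3 ≤ n) (h : Perm (Fin 3) × Perm (Fin 3)) :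
    Perm.sign (swapHom n p hp hn h) = Perm.sign h.1 * Perm.sign h.2 := by
  classical
  rw [← Perm.sign_sumCongr]
  let f := Equiv.ofInjective (swapPos n p hp) (swapPos_injective n p hp hn)
  have h1 : swapHom n p hp hn h = Perm.extendDomain (h.1.sumCongr h.2) f := by
    simp only [swapHom, MonoidHom.comp_apply, Perm.viaEmbeddingHom_apply, Perm.viaEmbedding]
    congr!
  rw [h1, Perm.sign_extendDomain]

theorem swapHom_inl (n p : ℕ) (hp : p + 2 ≤ n) (hn : 3 ≤ n) (h : Perm (Fin 3) × Perm (Fin 3))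
    (i : Fin 3) :
    swapHom n p hp hn h (swapPos n p hp (Sum.inl i)) = swapPos n p hp (Sum.inl (h.1 i)) :=
  Perm.viaEmbedding_apply _ ⟨swapPos n p hp, swapPos_injective n p hp hn⟩ (Sum.inl i)

theorem swapHom_inr (n p : ℕ) (hp : p + 2 ≤ n) (hn : 3 ≤ n) (h : Perm (Fin 3) × Perm (Fin 3))
    (i : Fin 3) :
    swapHom n p hp hn h (swapPos n p hp (Sum.inr i)) = swapPos n p hp (Sum.inr (h.2 i)) :=
  Perm.viaEmbedding_apply _ ⟨swapPos n p hp, swapPos_injective n p hp hn⟩ (Sum.inr i)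

theorem map_mul_swapHom (n p : ℕ) (hp : p + 2 ≤ n) (hn : 3 ≤ n) {W : Finset (Fin (2 * n))}
    (hl : ∀ i j, swapPos n p hp (Sum.inl i) ∈ W → swapPos n p hp (Sum.inl j) ∈ W)
    (hr : ∀ i j, swapPos n p hp (Sum.inr i) ∈ W → swapPos n p hp (Sum.inr j) ∈ W)
    (σ : Perm (Fin (2 * n))) (h : Perm (Fin 3) × Perm (Fin 3)) :
    W.map (σ * swapHom n p hp hn h).toEmbedding = W.map σ.toEmbedding := by
  apply map_mul_of_mem_iff
  intro x
  by_cases hx : x ∈ Set.range (swapPos n p hp)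
  · obtain ⟨i | i, rfl⟩ := hx
    · rw [swapHom_inl]; exact ⟨hl _ _, hl _ _⟩
    · rw [swapHom_inr]; exact ⟨hr _ _, hr _ _⟩
  · have : swapHom n p hp hn h x = x :=
      Perm.viaEmbedding_apply_of_notMem _ ⟨swapPos n p hp, swapPos_injective n p hp hn⟩ x hx
    rw [this]

variable {K : Type*} [Field K] {V : Type*} [AddCommGroup V] [Module K V]

/-- The case of four vectors in the plane. -/
theorem altSum_piK2_eq_zero_of_plane {ω : V [⋀^Fin (0 + 2 + 0)]→ₗ[K] K} (hω : IsVolumeForm ω)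
    {l : Fin (2 * (0 + 2 + 0)) → V} (hl : IsGeneric K (0 + 2 + 0) l)
    {φ : Finset (Fin (2 * (0 + 2 + 0))) → UnitGroup K} (hφ : IsVolumeFunction ω l φ) :
    altSum (fun σ : Perm (Fin (2 * (0 + 2 + 0))) => twiceMultilinear (piK2 K 0 0)
      fun k => φ ((window (0 + 2 + 0) k).map σ.toEmbedding)) = 0 := by
  have hB := isSteinbergSymbol_symbolForm (F := K) 0 0 0
  let d : Fin 4 → Fin 4 → UnitGroup K := fun i j => φ (insert i (insert j ∅))
  have hd : ∀ i j, d i j = d j i := fun i j => by simp only [d]; rw [Finset.insert_comm]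
  rw [← altSum_fin_four_symbol (symbolForm 0 0 0) hB.self_eq_zero d hd
    (hφ.symbol_relation hω hl hB (S := ∅) rfl (x := id) Function.injective_id (by simp)
      fun i j => rfl)]
  refine altSum_congr (N := 4) fun σ => ?_
  rw [twiceMultilinear_piK2_eq (w := 0) 0 0 (fun k h0 h1 => ?_)]
  · have w0 : window (0 + 2 + 0) (symbolPos 0 0 0) = insert (0 : Fin 4) (insert 1 ∅) := by decide
    have w1 : window (0 + 2 + 0) (symbolPos 0 0 1) = insert (1 : Fin 4) (insert 2 ∅) := by decide
    rw [w0, w1]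
    have hmap : ∀ a b : Fin 4, (insert a (insert b ∅) : Finset (Fin 4)).map σ.toEmbedding =
        insert (σ a) (insert (σ b) ∅) := fun a b => by simp
    rw [hmap, hmap]
  · exfalso
    rw [ne_eq, Fin.ext_iff] at h0 h1
    simp only [symbolPos_val] at h0 h1
    have := k.2
    omega

theorem altSum_piK2_eq_zero {p q : ℕ} (hn : 3 ≤ p + 2 + q) {ω : V [⋀^Fin (p + 2 + q)]→ₗ[K] K}
    (hω : IsVolumeForm ω) {l : Fin (2 * (p + 2 + q)) → V} (hl : IsGeneric K (p + 2 + q) l)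
    {φ : Finset (Fin (2 * (p + 2 + q))) → UnitGroup K} (hφ : IsVolumeFunction ω l φ) :
    altSum (fun σ : Perm (Fin (2 * (p + 2 + q))) => twiceMultilinear (piK2 K p q)
      fun k => φ ((window (p + 2 + q) k).map σ.toEmbedding)) = 0 := by
  have hp : p + 2 ≤ p + 2 + q := by omega
  refine altSum_eq_zero_of_coset (swapHom _ p hp hn) (swapHom_injective _ p hp hn) fun σ => ?_
  let w : Fin (p + 2 + q) → UnitGroup K := fun k => φ ((window _ k).map σ.toEmbedding)
  have hB := isSteinbergSymbol_symbolForm p q w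
  -- The positions common to the two windows `p` and `p + 1`, except for `p + 1` and `p + n - 1`.
  let M : Finset (Fin (2 * (p + 2 + q))) :=
    Finset.univ.filter fun i => p + 2 ≤ (i : ℕ) ∧ (i : ℕ) < p + (p + 2 + q) - 1
  have hM : ∀ i, i ∈ M ↔ p + 2 ≤ (i : ℕ) ∧ (i : ℕ) < p + (p + 2 + q) - 1 := by simp [M]
  have hMl : ∀ i, swapPos _ p hp (Sum.inl i) ∉ M := by
    intro i
    rw [hM, swapPos_inl_val]
    split_ifs <;> omega
  have hMr : ∀ i, swapPos _ p hp (Sum.inr i) ∉ M := by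
    intro i
    rw [hM, swapPos_inr_val]
    omega
  let N := M.map σ.toEmbedding
  let x : Fin 3 → Fin (2 * (p + 2 + q)) := fun i => σ (swapPos _ p hp (Sum.inl i))
  let y : Fin 3 → Fin (2 * (p + 2 + q)) := fun i => σ (swapPos _ p hp (Sum.inr i))
  let u : Fin 3 → Fin 3 → Fin 3 → UnitGroup K := fun i j k =>
    φ (insert (y k) (insert (x j) (insert (x i) N)))
  let v : Fin 3 → Fin 3 → Fin 3 → UnitGroup K := fun i j k =>
    φ (insert (y j) (insert (y k) (insert (x i) N)))
  have hW0 : window _ (symbolPos p q 0) = insert (swapPos _ p hp (Sum.inr 0))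
      (insert (swapPos _ p hp (Sum.inl 2)) (insert (swapPos _ p hp (Sum.inl 1)) M)) := by
    ext i
    simp only [Finset.mem_insert, mem_window, hM, Fin.ext_iff, swapPos_inl_val, swapPos_inr_val,
      symbolPos_val]
    simp
    omega
  have hne : ∀ i j, i ≠ j → swapPos _ p hp i ≠ swapPos _ p hp j := fun i j h =>
    (swapPos_injective _ p hp hn).ne h
  have hMcard : M.card + 3 = p + 2 + q := by
    have h := card_window (symbolPos p q 0)
    rw [hW0, Finset.card_insert_of_notMem, Finset.card_insert_of_notMem,
      Finset.card_insert_of_notMem (hMl 1)] at h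
    · exact h
    · simpa [hMl] using hne _ _ (by simp)
    · simp only [Finset.mem_insert, hMr, or_false, not_or]
      exact ⟨hne _ _ (by simp), hne _ _ (by simp)⟩
  have hW1 : window _ (symbolPos p q 1) = insert (swapPos _ p hp (Sum.inr 0))
      (insert (swapPos _ p hp (Sum.inr 1)) (insert (swapPos _ p hp (Sum.inl 2)) M)) := by
    ext i
    simp only [Finset.mem_insert, mem_window, hM, Fin.ext_iff, swapPos_inl_val, swapPos_inr_val,
      symbolPos_val]
    simp
    omega
  have key : ∀ h : Perm (Fin 3) × Perm (Fin 3), twiceMultilinear (piK2 K p q)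
      (fun k => φ ((window _ k).map (σ * swapHom _ p hp hn h).toEmbedding)) =
      symbolForm p q w (u (h.1 1) (h.1 2) (h.2 0)) (v (h.1 2) (h.2 0) (h.2 1)) := by
    intro h
    have hN : M.map (σ * swapHom _ p hp hn h).toEmbedding = N :=
      map_mul_swapHom _ p hp hn (fun i _ hi => absurd hi (hMl i)) (fun i _ hi => absurd hi (hMr i))
        σ h
    have hx : ∀ i, (σ * swapHom _ p hp hn h) (swapPos _ p hp (Sum.inl i)) = x (h.1 i) := by
      intro i
      rw [Perm.mul_apply, swapHom_inl]
    have hy : ∀ i, (σ * swapHom _ p hp hn h) (swapPos _ p hp (Sum.inr i)) = y (h.2 i) := by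
      intro i
      rw [Perm.mul_apply, swapHom_inr]
    rw [twiceMultilinear_piK2_eq (w := w) p q]
    · simp only [hW0, hW1, Finset.map_insert, Equiv.coe_toEmbedding, hx, hy, hN, u, v]
    · intro k h0 h1
      rw [ne_eq, Fin.ext_iff, symbolPos_val] at h0 h1
      refine congrArg φ (map_mul_swapHom _ p hp hn ?_ ?_ σ h)
      · intro i j
        have := k.2
        simp only [mem_window, swapPos_inl_val]
        simp at h0 h1
        split_ifs <;> omega
      · intro i j
        simp only [mem_window, swapPos_inr_val]
        simp at h0 h1
        omega
  simp only [key, sign_swapHom]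
  rw [Fintype.sum_prod_type]
  have hσ : Function.Injective fun i => σ (swapPos _ p hp i) :=
    σ.injective.comp (swapPos_injective _ p hp hn)
  have := altSum_fin_three_symbol (symbolForm p q w) hB.self_eq_zero u v
    (fun i j k => by simp only [u]; rw [Finset.insert_comm (x j)])
    (fun i j k => by simp only [v]; rw [Finset.insert_comm (y j)]) (fun i j hij => by
      have hxN : ∀ i, x i ∉ N := fun i hi => hMl i (by simpa [N, x] using hi)
      have hyN : ∀ i, y i ∉ N := fun i hi => hMr i (by simpa [N, y] using hi)
      have hinj : Function.Injective ![y 0, y 1, y 2, x j] := by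
        have e : ![y 0, y 1, y 2, x j] = (fun i => σ (swapPos _ p hp i)) ∘
            ![Sum.inr 0, Sum.inr 1, Sum.inr 2, Sum.inl j] := by
          funext a
          fin_cases a <;> rfl
        rw [e]
        refine hσ.comp ?_
        intro a b
        fin_cases a <;> fin_cases b <;> simp
      have hxy : ∀ i k, x i ≠ y k := fun i k h => by simpa using hσ h
      have hxx : x j ≠ x i := fun h => hij (by simpa using (hσ h).symm)
      have hrel := hφ.symbol_relation hω hl hB (S := insert (x i) N)
        (by rw [Finset.card_insert_of_notMem (hxN i), Finset.card_map]; omega) hinj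
        (by
          intro a
          rw [Finset.mem_insert, not_or]
          fin_cases a
          · exact ⟨(hxy i 0).symm, hyN 0⟩
          · exact ⟨(hxy i 1).symm, hyN 1⟩
          · exact ⟨(hxy i 2).symm, hyN 2⟩
          · exact ⟨hxx, hxN j⟩) (fun _ _ => rfl)
      exact hrel)
  rw [← this]
  unfold altSum
  refine Finset.sum_congr rfl fun h _ => ?_
  rw [Finset.smul_sum]
  refine Finset.sum_congr rfl fun h' _ => ?_
  rw [Units.val_mul, mul_smul]

/-- `Iₙ` is integrable for every generic configuration over a field. -/
theorem isIntegrable_grassI {n : ℕ} {ω : V [⋀^Fin n]→ₗ[K] K} (hω : IsVolumeForm ω)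
    {l : Fin (2 * n) → V} (hl : IsGeneric K n l) : IsIntegrable (grassI ω l) := by
  intro p q h
  subst h
  obtain ⟨φ, hφ⟩ := exists_isVolumeFunction ω l
  rw [TensorPower.cast_refl, LinearEquiv.refl_apply, eqModTwoTorsion_iff, smul_zero,
    two_smul_map_grassI hφ]
  by_cases hn : 3 ≤ p + 2 + q
  · exact altSum_piK2_eq_zero hn hω hl hφ
  · obtain rfl : p = 0 := by omega
    obtain rfl : q = 0 := by omega
    exact altSum_piK2_eq_zero_of_plane hω hl hφ

end Integrability

/-! ### The universal configuration -/

section Universal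

variable {n : ℕ}

theorem stdVolume_basisFun (R : Type*) [CommRing R] :
    stdVolume n R (Pi.basisFun R (Fin n)) = 1 := by
  have := (Pi.basisFun R (Fin n)).det_self
  rwa [Pi.basisFun_det] at this

theorem isVolumeForm_stdVolume (R : Type*) [CommRing R] : IsVolumeForm (stdVolume n R) :=
  ⟨Pi.basisFun R (Fin n), by rw [stdVolume_basisFun]; exact isUnit_one⟩

theorem isGeneric_of_isUnit {R : Type*} [CommRing R] {ι : Type*} {l : ι → Fin n → R}
    (h : ∀ s : Fin n ↪ ι, IsUnit (stdVolume n R (l ∘ s))) : IsGeneric R n l := by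
  intro s
  have := (Module.Basis.is_basis_iff_det (Pi.basisFun R (Fin n)) (v := l ∘ s)).mpr (by
    rw [Pi.basisFun_det]; exact h s)
  exact ⟨this.1, this.2.ge⟩

theorem map_normalForm {R S : Type*} [CommRing R] [CommRing S] (f : R →+* S)
    (X : Matrix (Fin n) (Fin n) R) (c : Fin (2 * n)) (i : Fin n) :
    f (normalForm X c i) = normalForm (X.map f) c i := by
  unfold normalForm
  split_ifs with h
  · by_cases hi : i = ⟨c, h⟩
    · subst hi; simp
    · simp [Pi.single_eq_of_ne hi]
  · rfl

theorem map_stdVolume {R S : Type*} [CommRing R] [CommRing S] (f : R →+* S)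
    (v : Fin n → Fin n → R) : f (stdVolume n R v) = stdVolume n S (fun a i => f (v a i)) :=
  f.map_det (Matrix.of v)

theorem map_stdVolume_normalForm {R S : Type*} [CommRing R] [CommRing S] (f : R →+* S)
    (X : Matrix (Fin n) (Fin n) R) (s : Fin n ↪ Fin (2 * n)) :
    f (stdVolume n R (normalForm X ∘ s)) = stdVolume n S (normalForm (X.map f) ∘ s) := by
  rw [map_stdVolume]
  congr 1
  funext a i
  exact map_normalForm f X (s a) i

/-- For every choice of `n` columns there is a permutation matrix `X` for which these columns of
`(1 | X)` are the standard basis vectors, in some order. -/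
theorem exists_stdVolume_normalForm_ne_zero (k : Type*) [Field k] (s : Fin n ↪ Fin (2 * n)) :
    ∃ X : Matrix (Fin n) (Fin n) k, stdVolume n k (normalForm X ∘ s) ≠ 0 := by
  -- The columns taken from the identity matrix determine part of a permutation `ρ`.
  obtain ⟨ρ, hρ⟩ := Perm.exists_extending_pair
    (fun a : {a : Fin n // (s a : ℕ) < n} => (a : Fin n)) (fun a => ⟨s a, a.2⟩)
    Subtype.val_injective (fun a b h => by
      simp only [Fin.mk.injEq] at h
      exact Subtype.ext (s.injective (Fin.ext h)))
  obtain ⟨τ, hτ⟩ := Perm.exists_extending_pair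
    (fun a : {a : Fin n // ¬ (s a : ℕ) < n} => (⟨s a - n, by omega⟩ : Fin n)) (fun a => ρ a)
    (fun a b h => by
      simp only [Fin.mk.injEq] at h
      have ha := a.2
      have hb := b.2
      exact Subtype.ext (s.injective (Fin.ext (by omega))))
    (ρ.injective.comp Subtype.val_injective)
  refine ⟨fun i j => Pi.single (M := fun _ => k) (τ j) 1 i, ?_⟩
  have h : normalForm (fun i j => Pi.single (M := fun _ => k) (τ j) 1 i) ∘ s =
      Pi.basisFun k (Fin n) ∘ ρ := by
    funext a
    simp only [Function.comp_apply, normalForm, Pi.basisFun_apply]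
    split_ifs with ha
    · rw [← hρ ⟨a, ha⟩]
    · rw [← hτ ⟨a, ha⟩]
  rw [h, AlternatingMap.map_perm, stdVolume_basisFun]
  rcases Int.units_eq_one_or (Perm.sign ρ) with h | h <;> simp [h]

variable (n) (k : Type*) [Field k]

/-- The matrix of coordinate functions, over the polynomial ring. -/
noncomputable def polyMatrix : Matrix (Fin n) (Fin n) (MvPolynomial (Fin n × Fin n) k) :=
  fun i j => MvPolynomial.X (i, j)

/-- The matrix of coordinate functions, over the coordinate ring. -/
noncomputable def coordMatrix : Matrix (Fin n) (Fin n) (coordRing n k) :=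
  fun i j => ⟨genericMatrix n k i j, Algebra.subset_adjoin (Or.inl ⟨i, j, rfl⟩)⟩

variable {n}

theorem stdVolume_genericMatrix_ne_zero (s : Fin n ↪ Fin (2 * n)) :
    stdVolume n (FunctionField n k) (normalForm (genericMatrix n k) ∘ s) ≠ 0 := by
  have h1 : genericMatrix n k = (polyMatrix n k).map
      (algebraMap (MvPolynomial (Fin n × Fin n) k) (FunctionField n k)) := rfl
  rw [h1, ← map_stdVolume_normalForm, ne_eq,
    FaithfulSMul.algebraMap_eq_zero_iff]
  obtain ⟨X, hX⟩ := exists_stdVolume_normalForm_ne_zero k s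
  intro h0
  apply hX
  have h2 : X = (polyMatrix n k).map (MvPolynomial.eval fun x : Fin n × Fin n => X x.1 x.2) := by
    ext i j
    simp [polyMatrix]
  rw [h2, ← map_stdVolume_normalForm, h0, map_zero]

theorem isGeneric_genericMatrix :
    IsGeneric (FunctionField n k) n (normalForm (genericMatrix n k)) :=
  isGeneric_of_isUnit fun s => (stdVolume_genericMatrix_ne_zero k s).isUnit

theorem val_stdVolume_universalConfig (s : Fin n ↪ Fin (2 * n)) :
    ((stdVolume n (coordRing n k) (universalConfig n k ∘ s) : coordRing n k) :
      FunctionField n k) =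
      stdVolume n (FunctionField n k) (normalForm (genericMatrix n k) ∘ s) :=
  map_stdVolume_normalForm (coordRing n k).val.toRingHom (coordMatrix n k) s

theorem isUnit_stdVolume_universalConfig (s : Fin n ↪ Fin (2 * n)) :
    IsUnit (stdVolume n (coordRing n k) (universalConfig n k ∘ s)) := by
  refine IsUnit.of_mul_eq_one ⟨_, Algebra.subset_adjoin (Or.inr ⟨s, rfl⟩)⟩ (Subtype.ext ?_)
  rw [MulMemClass.coe_mul, val_stdVolume_universalConfig]
  exact mul_inv_cancel₀ (stdVolume_genericMatrix_ne_zero k s)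

theorem isGeneric_universalConfig : IsGeneric (coordRing n k) n (universalConfig n k) :=
  isGeneric_of_isUnit (isUnit_stdVolume_universalConfig k)

theorem mapTensor_grassI {R S : Type*} [CommRing R] [CommRing S] (f : R →+* S)
    {l : Fin (2 * n) → Fin n → R} (hl : IsGeneric R n l) :
    mapTensor n (Units.map (f : R →* S)) (grassI (stdVolume n R) l) =
      grassI (stdVolume n S) (fun c i => f (l c i)) := by
  unfold grassI
  rw [map_sum]
  refine Finset.sum_congr rfl fun σ _ => ?_
  rw [map_smul, windowTensor, windowTensor, mapTensor, PiTensorProduct.map_tprod]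
  congr 2
  funext a
  obtain ⟨u, hu⟩ := isUnit_of_isGeneric (isVolumeForm_stdVolume R) hl
    ((windowEmb n a).trans σ.toEmbedding)
  have h1 : stdVolume n S (fun j => fun i => f ((l ∘ σ) (windowEmb n a j) i)) =
      (Units.map (f : R →* S) u : Sˣ) := by
    rw [Units.coe_map, hu]
    exact (map_stdVolume f _).symm
  refine Eq.trans ?_ (congrArg toUnitGroup h1).symm
  rw [toUnitGroup_coe]
  refine (congrArg (MonoidHom.toAdditive (Units.map (f : R →* S))).toIntLinearMap
    ((congrArg toUnitGroup hu.symm).trans (toUnitGroup_coe u))).trans rfl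

theorem mapTensor_universalI :
    mapTensor n (toFunctionField n k) (universalI n k) =
      grassI (stdVolume n (FunctionField n k)) (normalForm (genericMatrix n k)) := by
  refine (mapTensor_grassI (coordRing n k).val.toRingHom (isGeneric_universalConfig k)).trans ?_
  congr 1
  funext c i
  exact map_normalForm (coordRing n k).val.toRingHom (coordMatrix n k) c i

end Universal

/-! ### Descent to `PGₙ` -/

section Projective

variable {n : ℕ} (k : Type*) [Field k]

/-- The rational functions of degree zero for the torus action: quotients of polynomials of the
same weight. -/
def degreeZero (n : ℕ) (k : Type*) [Field k] : Subring (FunctionField n k) where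
  carrier := {f | ∃ (d : (Fin n → ℕ) × (Fin n → ℕ)) (p q : MvPolynomial (Fin n × Fin n) k),
    q ≠ 0 ∧ MvPolynomial.IsWeightedHomogeneous (torusWeight n) p d ∧
    MvPolynomial.IsWeightedHomogeneous (torusWeight n) q d ∧
    f = algebraMap _ (FunctionField n k) p / algebraMap _ (FunctionField n k) q}
  one_mem' := ⟨0, 1, 1, one_ne_zero, MvPolynomial.isWeightedHomogeneous_one _ _,
    MvPolynomial.isWeightedHomogeneous_one _ _, by simp⟩
  zero_mem' := ⟨0, 0, 1, one_ne_zero, MvPolynomial.isWeightedHomogeneous_zero _ _ _,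
    MvPolynomial.isWeightedHomogeneous_one _ _, by simp⟩
  mul_mem' := by
    rintro _ _ ⟨d, p, q, hq, hp', hq', rfl⟩ ⟨e, r, s, hs, hr', hs', rfl⟩
    exact ⟨d + e, p * r, q * s, mul_ne_zero hq hs, hp'.mul hr', hq'.mul hs', by
      rw [map_mul, map_mul, div_mul_div_comm]⟩
  add_mem' := by
    rintro _ _ ⟨d, p, q, hq, hp', hq', rfl⟩ ⟨e, r, s, hs, hr', hs', rfl⟩
    refine ⟨d + e, p * s + q * r, q * s, mul_ne_zero hq hs,
      (MvPolynomial.weightedHomogeneousSubmodule k (torusWeight n) (d + e)).add_mem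
        (hp'.mul hs') (hq'.mul hr'), hq'.mul hs', ?_⟩
    have h1 : algebraMap _ (FunctionField n k) q ≠ 0 :=
      (FaithfulSMul.algebraMap_eq_zero_iff _ _).not.mpr hq
    have h2 : algebraMap _ (FunctionField n k) s ≠ 0 :=
      (FaithfulSMul.algebraMap_eq_zero_iff _ _).not.mpr hs
    rw [map_add, map_mul, map_mul, map_mul, div_add_div _ _ h1 h2]
  neg_mem' := by
    rintro _ ⟨d, p, q, hq, hp', hq', rfl⟩
    exact ⟨d, -p, q, hq,
      (MvPolynomial.weightedHomogeneousSubmodule k (torusWeight n) d).neg_mem hp', hq', by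
      rw [map_neg, neg_div]⟩

theorem mem_unitsPG_of_mem_degreeZero {u : (coordRing n k)ˣ}
    (hu : ((u : coordRing n k) : FunctionField n k) ∈ degreeZero n k) : u ∈ unitsPG n k := by
  obtain ⟨d, p, q, hq, hp', hq', h⟩ := hu
  refine ⟨d, p, q, ?_, hq, hp', hq', h⟩
  rintro rfl
  rw [map_zero, zero_div] at h
  exact u.ne_zero (Subtype.ext h)

/-- The entries of a matrix `X` are maximal minors of `(1 | X)`. -/
theorem exists_stdVolume_normalForm_eq {R : Type*} [CommRing R] (X : Matrix (Fin n) (Fin n) R)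
    (i j : Fin n) : ∃ s : Fin n ↪ Fin (2 * n), stdVolume n R (normalForm X ∘ s) = X i j := by
  let f : Fin n → Fin (2 * n) := fun a => if a = i then ⟨n + j, by omega⟩ else ⟨a, by omega⟩
  have hfi : f i = ⟨n + j, by omega⟩ := if_pos rfl
  have hf : ∀ a, a ≠ i → f a = ⟨a, by omega⟩ := fun a ha => if_neg ha
  have hinj : Function.Injective f := by
    intro a b h
    by_cases ha : a = i <;> by_cases hb : b = i
    · rw [ha, hb]
    · rw [ha, hfi, hf b hb, Fin.mk.injEq] at h; omega
    · rw [hb, hfi, hf a ha, Fin.mk.injEq] at h; omega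
    · rw [hf a ha, hf b hb, Fin.mk.injEq] at h; exact Fin.ext h
  refine ⟨⟨f, hinj⟩, ?_⟩
  have h1 : normalForm X ∘ f = (1 : Matrix (Fin n) (Fin n) R).updateRow i (fun a => X a j) := by
    funext a
    by_cases ha : a = i
    · subst ha
      rw [Matrix.updateRow_self]
      simp [hfi, normalForm]
    · rw [Matrix.updateRow_ne ha]
      funext b
      simp [hf a ha, normalForm, Matrix.one_apply, Pi.single_apply, eq_comm]
  change stdVolume n R (normalForm X ∘ f) = _
  rw [h1]
  change Matrix.det _ = _
  rw [← Matrix.cramer_transpose_apply, Matrix.transpose_one, Matrix.cramer_one]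
  rfl

theorem isUnit_coordMatrix (i j : Fin n) : IsUnit (coordMatrix n k i j) := by
  obtain ⟨s, hs⟩ := exists_stdVolume_normalForm_eq (coordMatrix n k) i j
  rw [← hs]
  exact isUnit_stdVolume_universalConfig k s

/-- Multiplying the rows of `X` by `r i` and the columns by `t j` amounts, up to the action of the
linear group, to rescaling the columns of `(1 | X)`. -/
theorem exists_normalForm_rescale {R : Type*} [CommRing R] (X : Matrix (Fin n) (Fin n) R)
    (r t : Fin n → Rˣ) : ∃ (g : (Fin n → R) ≃ₗ[R] (Fin n → R)) (a : Fin (2 * n) → Rˣ), ∀ c,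
      normalForm (fun i j => r i * X i j * t j) c = (a c : R) • g (normalForm X c) := by
  refine ⟨LinearEquiv.piCongrRight fun i => LinearEquiv.smulOfUnit (r i),
    fun c => if h : (c : ℕ) < n then (r ⟨c, h⟩)⁻¹ else t ⟨(c : ℕ) - n, by omega⟩, fun c => ?_⟩
  funext i
  change _ = _ * (r i * normalForm X c i)
  by_cases h : (c : ℕ) < n
  · simp only [normalForm, dif_pos h]
    by_cases hi : i = ⟨c, h⟩
    · subst hi; simp
    · simp [Pi.single_eq_of_ne hi]
  · simp only [normalForm, dif_neg h]
    ring

/-- Rescaling the vectors replaces `x_{ij}` by the torus invariant function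
`x_{ij} x_{00} / (x_{i0} x_{0j})`, and `Iₙ` does not change modulo 2-torsion. -/
theorem exists_eqModTwoTorsion_universalI (hn : 2 ≤ n) :
    ∃ J : ⨂[ℤ]^n (Additive (unitsPG n k)),
      EqModTwoTorsion (mapTensor n (unitsPG n k).subtype J) (universalI n k) := by
  choose x hx using isUnit_coordMatrix (n := n) k
  let o : Fin n := ⟨0, by omega⟩
  let r : Fin n → (coordRing n k)ˣ := fun i => (x i o)⁻¹
  let t : Fin n → (coordRing n k)ˣ := fun j => x o o * (x o j)⁻¹
  let X' : Matrix (Fin n) (Fin n) (coordRing n k) := fun i j => r i * coordMatrix n k i j * t j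
  obtain ⟨g, a, hl'⟩ := exists_normalForm_rescale (coordMatrix n k) r t
  have hgen := isGeneric_universalConfig (n := n) k
  have hω := isVolumeForm_stdVolume (n := n) (coordRing n k)
  have hunit : ∀ s : Fin n ↪ Fin (2 * n),
      IsUnit (stdVolume n (coordRing n k) (normalForm X' ∘ s)) := by
    intro s
    obtain ⟨c, hc⟩ := hω.exists_unit_rescale hω g a hl'
    rw [hc]
    exact (Units.isUnit _).mul (isUnit_of_isGeneric hω hgen s)
  choose u hu using hunit
  have hval : ∀ i j, ((X' i j : coordRing n k) : FunctionField n k) ∈ degreeZero n k := by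
    intro i j
    have hinv : ∀ i j, (((x i j)⁻¹ : (coordRing n k)ˣ) : FunctionField n k) =
        (genericMatrix n k i j)⁻¹ := by
      intro i j
      refine eq_inv_of_mul_eq_one_left ?_
      have := congrArg Subtype.val (x i j).inv_mul
      rw [hx] at this
      exact this
    refine ⟨torusWeight n (i, j) + torusWeight n (o, o),
      MvPolynomial.X (i, j) * MvPolynomial.X (o, o), MvPolynomial.X (i, o) * MvPolynomial.X (o, j),
      mul_ne_zero (MvPolynomial.X_ne_zero _) (MvPolynomial.X_ne_zero _),
      (MvPolynomial.isWeightedHomogeneous_X _ _ _).mul (MvPolynomial.isWeightedHomogeneous_X _ _ _),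
      ?_, ?_⟩
    · have : torusWeight n (i, j) + torusWeight n (o, o) =
          torusWeight n (i, o) + torusWeight n (o, j) := by
        simp only [torusWeight, Prod.mk_add_mk, add_comm]
      rw [this]
      exact (MvPolynomial.isWeightedHomogeneous_X _ _ _).mul
        (MvPolynomial.isWeightedHomogeneous_X _ _ _)
    · have hx' : ∀ i j, ((x i j : coordRing n k) : FunctionField n k) = genericMatrix n k i j :=
        fun i j => congrArg Subtype.val (hx i j)
      have hc : ((coordMatrix n k i j : coordRing n k) : FunctionField n k) =
        genericMatrix n k i j := rfl
      simp only [X', r, t, Units.val_mul, MulMemClass.coe_mul, hinv, hx', hc, map_mul]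
      simp only [genericMatrix, div_eq_mul_inv, mul_inv]
      ring
  have hmem : ∀ s, u s ∈ unitsPG n k := by
    intro s
    apply mem_unitsPG_of_mem_degreeZero
    rw [hu]
    let Y : Matrix (Fin n) (Fin n) (degreeZero n k) := fun i j => ⟨_, hval i j⟩
    have h1 := map_stdVolume_normalForm (degreeZero n k).subtype Y s
    have h2 := map_stdVolume_normalForm (coordRing n k).val.toRingHom X' s
    have h3 : ((stdVolume n (coordRing n k) (normalForm X' ∘ s) : coordRing n k) :
        FunctionField n k) = (degreeZero n k).subtype (stdVolume n _ (normalForm Y ∘ s)) :=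
      h2.trans h1.symm
    rw [h3]
    exact Subtype.property _
  refine ⟨∑ σ : Perm (Fin (2 * n)), ((Perm.sign σ : ℤˣ) : ℤ) • PiTensorProduct.tprod ℤ
    (fun b : Fin n => Additive.ofMul
      (⟨u ((windowEmb n b).trans σ.toEmbedding), hmem _⟩ : unitsPG n k)), ?_⟩
  have hJ : ∀ σ : Perm (Fin (2 * n)), mapTensor n (unitsPG n k).subtype (PiTensorProduct.tprod ℤ
      (fun b : Fin n => Additive.ofMul
        (⟨u ((windowEmb n b).trans σ.toEmbedding), hmem _⟩ : unitsPG n k))) =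
      windowTensor (stdVolume n (coordRing n k)) (normalForm X' ∘ σ) := by
    intro σ
    rw [mapTensor, PiTensorProduct.map_tprod, windowTensor]
    congr 1
    funext b
    refine Eq.trans ?_ ((toUnitGroup_coe _).symm.trans
      (congrArg toUnitGroup (hu ((windowEmb n b).trans σ.toEmbedding))))
    rfl
  simp only [map_sum, map_smul, hJ]
  exact eqModTwoTorsion_grassI_smul hn hω hω hgen g a hl'

end Projective

end Grassmannian

theorem theorem4p3 (n : ℕ) (hn : 1 ≤ n) :
    -- The element is defined on the moduli space: the universal configuration is generic, and
    -- its image over the function field is integrable.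
    (∀ (k : Type*) [Field k],
      IsGeneric (coordRing n k) n (universalConfig n k) ∧
      IsIntegrable (mapTensor n (toFunctionField n k) (universalI n k))) ∧
    -- More generally it is integrable for every generic configuration over every field.
    (∀ (K : Type*) [Field K] (V : Type*) [AddCommGroup V] [Module K V]
      (ω : V [⋀^Fin n]→ₗ[K] K), IsVolumeForm ω →
      ∀ l : Fin (2 * n) → V, IsGeneric K n l → IsIntegrable (grassI ω l)) ∧
    -- For `n ≥ 2` it depends only on the configuration of points in projective space ...
    (2 ≤ n → ∀ (R : Type*) [CommRing R] (V V' : Type*) [AddCommGroup V] [Module R V]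
      [AddCommGroup V'] [Module R V'] (ω : V [⋀^Fin n]→ₗ[R] R) (ω' : V' [⋀^Fin n]→ₗ[R] R),
      IsVolumeForm ω → IsVolumeForm ω' →
      ∀ (l : Fin (2 * n) → V) (l' : Fin (2 * n) → V'), IsGeneric R n l →
      ∀ (g : V ≃ₗ[R] V') (a : Fin (2 * n) → Rˣ), (∀ i, l' i = (a i : R) • g (l i)) →
      EqModTwoTorsion (grassI ω' l') (grassI ω l)) ∧
    -- ... and comes from an element of the tensor power of the invertible functions on `PGₙ`.
    (2 ≤ n → ∀ (k : Type*) [Field k], ∃ J : ⨂[ℤ]^n (Additive (unitsPG n k)),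
      EqModTwoTorsion (mapTensor n (unitsPG n k).subtype J) (universalI n k)) ∧
    -- The `(2n+1)`-term relation.
    (∀ (R : Type*) [CommRing R] (V : Type*) [AddCommGroup V] [Module R V]
      (ω : V [⋀^Fin n]→ₗ[R] R), IsVolumeForm ω →
      ∀ l : Fin (2 * n + 1) → V, IsGeneric R n l →
      ∑ i : Fin (2 * n + 1), (-1 : ℤ) ^ ((i : ℕ) + 1) • grassI ω (l ∘ i.succAbove) = 0) ∧
    -- The dual `(2n+1)`-term relation, for any choice of volume forms on the quotients.
    (∀ (R : Type*) [CommRing R] (V : Type*) [AddCommGroup V] [Module R V],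
      Nonempty (Module.Basis (Fin (n + 1)) R V) →
      ∀ m : Fin (2 * n + 1) → V, IsGeneric R (n + 1) m →
      ∀ ω : ∀ j : Fin (2 * n + 1), (V ⧸ Submodule.span R {m j}) [⋀^Fin n]→ₗ[R] R,
      (∀ j, IsVolumeForm (ω j)) →
      EqModTwoTorsion
        (∑ j : Fin (2 * n + 1), (-1 : ℤ) ^ ((j : ℕ) + 1) • grassI (ω j) (project R m j)) 0) := by
  refine ⟨fun k _ => ⟨isGeneric_universalConfig k, ?_⟩,
    fun K _ V _ _ ω hω l hl => isIntegrable_grassI hω hl,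
    fun hn2 R _ V V' _ _ _ _ ω ω' hω hω' l l' hl g a hl' =>
      eqModTwoTorsion_grassI_smul hn2 hω hω' hl g a hl',
    fun hn2 k _ => exists_eqModTwoTorsion_universalI k hn2,
    fun R _ V _ _ ω _ l _ => sum_grassI_succAbove ω hn l,
    fun R _ V _ _ ⟨b⟩ m hm ω hω => eqModTwoTorsion_sum_grassI_project hn b hm hω⟩
  rw [mapTensor_universalI]
  exact isIntegrable_grassI (isVolumeForm_stdVolume _) (isGeneric_genericMatrix k)
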